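/- For integers $K,L\ge 1$ let $S^{K,L}=(S_{pq})_{p,q=0}^{L}$ be the matrix with $S_{00}=K$, $S_{p,p+1}=1$ for $0\le p<L$, $S_{L0}=1$ and all other entries $0$. For $p\in\{0,\dots,L\}$ let $\mathbb T^{K,L}_p$ be the rooted tree with labelled vertices whose root $0^{(p)}$ has label $p$ and in which every vertex of label $q$ has exactly $S_{qr}$ children of label $r$; let $\mathbb T^{K,L}$ be the disjoint union of the trees $\mathbb T^{K,L}_0,\dots,\mathbb T^{K,L}_L$, and let $\Delta$ be the adjacency operator $(\Delta v)(x)=\sum_{y\sim x}v(y)$ on $\ell^2(\mathbb T^{K,L})$. For $\operatorname{Im}z>0$ put $\Gamma^{(p)}_z=\langle 0^{(p)}|(\Delta-z)^{-1}|0^{(p)}\rangle$, and for $E\in\mathbb R$ put $\Gamma^{(p)}_E=\lim_{\eta\downarrow0}\Gamma^{(p)}_{E+i\eta}$ if this limit exists in $\mathbb C$. Let $$I^{K,L}_p=\{E\in\mathbb R:\ \Gamma^{(p)}_E\text{ exists and }\operatorname{Im}\Gamma^{(p)}_E>0\},\qquad \mathcal E_L=\bigcup_{d=1}^{L}\sigma(\Delta_d),\qquad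 I^{K,L}=I^{K,L}_0\setminus\mathcal E_L,$$ where $\sigma(\Delta_d)$ is the set of eigenvalues of the $d\times d$ adjacency matrix $\Delta_d$ of the path with $d$ vertices ($\Delta_1=0$). Then: (i) For all $K,L\ge1$ and all $p\in\{0,\dots,L\}$ we have $I^{K,L}_p=I^{K,L}_0$. Each of the sets $I^{K,L}_0$ and $I^{K,L}$ is non-empty and is a union of finitely many bounded open intervals. For every $p$ the function $E\mapsto\Gamma^{(p)}_E$ is real-analytic on $I^{K,L}_0$. (ii) For all $K,L\ge1$ the absolutely continuous spectrum of $\Delta$, that is, the spectrum of the restriction of $\Delta$ to the closed subspace of all $\psi\in\ell^2(\mathbb T^{K,L})$ whose spectral measure is absolutely continuous with respect to Lebesgue measure, is $\sigma_{ac}(\Delta)=\overline{I^{K,L}}=\overline{I^{K,L}_0}$. (iii) For every $L\ge1$ and every $E_0\in\mathbb R$ there is $K_0=K_0(L,E_0)$ such that $[-E_0,E_0]\subset\overline{I^{K,L}}$ for all integers $K>K_0$. (iv) For the Fibonacci trees ($K=L=1$), $I^{1,1}=\left(-\tfrac32\sqrt3,\,0\right)\cup\left(0,\,\tfrac32\sqrt3\right)$.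 -/

import Mathlib

open Filter Topology MeasureTheory Set
open scoped CompactlySupported

/-! ### Trees and forests given by a substitution matrix -/

/-- `SubstTree S p` is the vertex set of the rooted tree with substitution matrix `S` whose root
has label `p`: every vertex with label `p` has exactly `S p q` children with label `q`.
A vertex is either the root, or it lies in the subtree of the `i`-th child of label `q`
of the root (`i : Fin (S p q)`), and this subtree is a copy of the tree with root label `q`. -/
inductive SubstTree {ι : Type} (S : Matrix ι ι ℕ) : ι → Type
  | root (p : ι) : SubstTree S p
  | sub {p : ι} (q : ι) (i : Fin (S p q)) (x : SubstTree S q) : SubstTree S p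

/-- `IsChild x y`: the vertex `y` is a child of the vertex `x`. -/
inductive SubstTree.IsChild {ι : Type} {S : Matrix ι ι ℕ} :
    ∀ {p : ι}, SubstTree S p → SubstTree S p → Prop
  | base {p : ι} (q : ι) (i : Fin (S p q)) :
      IsChild (SubstTree.root p) (SubstTree.sub q i (SubstTree.root q))
  | step {p : ι} (q : ι) (i : Fin (S p q)) {x y : SubstTree S q} (h : IsChild x y) :
      IsChild (SubstTree.sub (p := p) q i x) (SubstTree.sub q i y)

/-- The forest: the disjoint union of the trees `SubstTree S p` over all root labels `p`. -/
abbrev SubstForest {ι : Type} (S : Matrix ι ι ℕ) : Type := Σ p : ι, SubstTree S p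

/-- The forest as a graph: vertices are joined iff they lie in the same tree and one of them is a
child of the other (`SimpleGraph.fromRel` symmetrizes the relation). -/
def substForestGraph {ι : Type} (S : Matrix ι ι ℕ) : SimpleGraph (SubstForest S) :=
  SimpleGraph.fromRel fun x y =>
    ∃ (p : ι) (a b : SubstTree S p), x = ⟨p, a⟩ ∧ y = ⟨p, b⟩ ∧ a.IsChild b

/-- A bound for the number of children of a vertex. -/
theorem SubstTree.encard_children_le {ι : Type} [Fintype ι] (S : Matrix ι ι ℕ) {p : ι}
    (x : SubstTree S p) :
    {y | x.IsChild y}.encard ≤ ((∑ p : ι, ∑ q : ι, S p q : ℕ) : ℕ∞) := by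
  induction x with
  | root p =>
    have hsub : {y | (SubstTree.root p : SubstTree S p).IsChild y} ⊆
        (fun c : (Σ q : ι, Fin (S p q)) =>
          (SubstTree.sub c.1 c.2 (SubstTree.root c.1) : SubstTree S p)) '' Set.univ := by
      rintro y hy
      cases hy with
      | base q i => exact ⟨⟨q, i⟩, trivial, rfl⟩
    refine (Set.encard_le_encard hsub).trans ((Set.encard_image_le _ _).trans ?_)
    rw [Set.encard_univ, ENat.card_eq_coe_fintype_card]
    simp only [Fintype.card_sigma, Fintype.card_fin]
    exact_mod_cast Finset.single_le_sum (f := fun p => ∑ q : ι, S p q)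
      (fun _ _ => Nat.zero_le _) (Finset.mem_univ p)
  | sub q i x ih =>
    rename_i p
    have hsub : {y | (SubstTree.sub q i x : SubstTree S p).IsChild y} ⊆
        (fun z => (SubstTree.sub q i z : SubstTree S p)) '' {y | x.IsChild y} := by
      rintro y hy
      cases hy with
      | step _ _ h => exact ⟨_, h, rfl⟩
    exact (Set.encard_le_encard hsub).trans ((Set.encard_image_le _ _).trans ih)

/-- A vertex has at most one parent. -/
theorem SubstTree.encard_parents_le {ι : Type} (S : Matrix ι ι ℕ) {p : ι}
    (x : SubstTree S p) : {y : SubstTree S p | y.IsChild x}.encard ≤ 1 := by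
  induction x with
  | root p =>
    have : {y : SubstTree S p | y.IsChild (SubstTree.root p : SubstTree S p)} = ∅ := by
      ext y
      simp only [Set.mem_ofPred_eq, Set.mem_empty_iff_false, iff_false]
      intro hy
      cases hy
    simp [this]
  | sub q i x ih =>
    rename_i p
    cases x with
    | root =>
      rw [Set.encard_le_one_iff]
      intro a b ha hb
      cases ha with
      | base =>
        cases hb with
        | base => rfl
        | step _ _ h => cases h
      | step _ _ h => cases h
    | sub q' i' x' =>
      have hsub : {y : SubstTree S p | y.IsChild (SubstTree.sub q i (SubstTree.sub q' i' x'))} ⊆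
          (fun z => (SubstTree.sub q i z : SubstTree S p)) ''
            {y : SubstTree S q | y.IsChild (SubstTree.sub q' i' x')} := by
        rintro y hy
        cases hy with
        | step _ _ h => exact ⟨_, h, rfl⟩
      exact (Set.encard_le_encard hsub).trans ((Set.encard_image_le _ _).trans ih)

theorem substForestGraph_encard_neighborSet_le {ι : Type} [Fintype ι] (S : Matrix ι ι ℕ)
    (x : SubstForest S) :
    ((substForestGraph S).neighborSet x).encard ≤ ((∑ p : ι, ∑ q : ι, S p q + 1 : ℕ) : ℕ∞) := by
  obtain ⟨p, a⟩ := x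
  have hsub : (substForestGraph S).neighborSet ⟨p, a⟩ ⊆
      (fun b => (⟨p, b⟩ : SubstForest S)) '' {b | a.IsChild b} ∪
      (fun b => (⟨p, b⟩ : SubstForest S)) '' {b : SubstTree S p | b.IsChild a} := by
    rintro y hy
    rw [SimpleGraph.mem_neighborSet, substForestGraph, SimpleGraph.fromRel_adj] at hy
    have hy' := hy.2
    rcases hy' with ⟨p', a', b, h1, h2, h3⟩ | ⟨p', a', b, h1, h2, h3⟩
    · cases h1
      exact Or.inl ⟨b, h3, h2.symm⟩
    · cases h2
      exact Or.inr ⟨a', h3, h1.symm⟩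
  refine (Set.encard_le_encard hsub).trans ((Set.encard_union_le _ _).trans ?_)
  push_cast
  refine add_le_add ((Set.encard_image_le _ _).trans ?_)
    ((Set.encard_image_le _ _).trans (SubstTree.encard_parents_le S a))
  exact_mod_cast SubstTree.encard_children_le S a

noncomputable instance substForestGraph.locallyFinite {ι : Type} [Fintype ι] (S : Matrix ι ι ℕ) :
    (substForestGraph S).LocallyFinite := fun x =>
  (Set.finite_of_encard_le_coe (substForestGraph_encard_neighborSet_le S x)).fintype

theorem substForestGraph_degree_le {ι : Type} [Fintype ι] (S : Matrix ι ι ℕ) :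
    ∃ D : ℕ, ∀ x, (substForestGraph S).degree x ≤ D := by
  refine ⟨∑ p : ι, ∑ q : ι, S p q + 1, fun x => ?_⟩
  have h := substForestGraph_encard_neighborSet_le S x
  rw [Set.encard_eq_coe_toFinset_card] at h
  exact_mod_cast h

/-! ### The adjacency operator on `ℓ²` of a graph with bounded degrees -/

/-- The Hilbert space `ℓ²(V)` of square-summable functions `V → ℂ`. -/
abbrev EllTwo (V : Type) : Type := lp (fun _ : V => ℂ) 2

theorem sum_sq_neighbors_le {V : Type} (G : SimpleGraph V) [G.LocallyFinite] (D : ℕ)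
    (hD : ∀ x, G.degree x ≤ D) (v : EllTwo V) (s : Finset V) :
    ∑ x ∈ s, ‖∑ y ∈ G.neighborFinset x, v y‖ ^ (2 : ENNReal).toReal
      ≤ (D * ‖v‖) ^ (2 : ENNReal).toReal := by
  classical
  simp only [ENNReal.toReal_ofNat, Real.rpow_two]
  calc ∑ x ∈ s, ‖∑ y ∈ G.neighborFinset x, v y‖ ^ 2
      ≤ ∑ x ∈ s, D * ∑ y ∈ G.neighborFinset x, ‖v y‖ ^ 2 := by
        refine Finset.sum_le_sum fun x _ => ?_
        have h1 : ‖∑ y ∈ G.neighborFinset x, v y‖ ≤ ∑ y ∈ G.neighborFinset x, ‖v y‖ :=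
          norm_sum_le _ _
        have h2 : (∑ y ∈ G.neighborFinset x, ‖v y‖) ^ 2 ≤
            (G.neighborFinset x).card * ∑ y ∈ G.neighborFinset x, ‖v y‖ ^ 2 :=
          sq_sum_le_card_mul_sum_sq
        have h3 : ((G.neighborFinset x).card : ℝ) ≤ D := by
          exact_mod_cast (G.card_neighborFinset_eq_degree x).le.trans (hD x)
        have h4 : 0 ≤ ∑ y ∈ G.neighborFinset x, ‖v y‖ ^ 2 :=
          Finset.sum_nonneg fun _ _ => by positivity
        calc _ ≤ (∑ y ∈ G.neighborFinset x, ‖v y‖) ^ 2 := by gcongr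
          _ ≤ _ := h2
          _ ≤ _ := by gcongr
    _ = D * ∑ x ∈ s, ∑ y ∈ G.neighborFinset x, ‖v y‖ ^ 2 := by rw [Finset.mul_sum]
    _ = D * ∑ y ∈ s.biUnion (fun x => G.neighborFinset x),
          ∑ x ∈ s.filter (fun x => G.Adj x y), ‖v y‖ ^ 2 := by
        congr 1
        refine Finset.sum_comm' fun x y => ?_
        simp only [SimpleGraph.mem_neighborFinset, Finset.mem_filter, Finset.mem_biUnion]
        exact ⟨fun h => ⟨⟨h.1, h.2⟩, x, h.1, h.2⟩, fun h => ⟨h.1.1, h.1.2⟩⟩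
    _ ≤ D * ∑ y ∈ s.biUnion (fun x => G.neighborFinset x), D * ‖v y‖ ^ 2 := by
        refine mul_le_mul_of_nonneg_left (Finset.sum_le_sum fun y _ => ?_) (Nat.cast_nonneg _)
        rw [Finset.sum_const, nsmul_eq_mul]
        refine mul_le_mul_of_nonneg_right ?_ (by positivity)
        have : (s.filter (fun x => G.Adj x y)).card ≤ G.degree y := by
          rw [← G.card_neighborFinset_eq_degree y]
          refine Finset.card_le_card fun x hx => ?_
          rw [SimpleGraph.mem_neighborFinset]
          exact (Finset.mem_filter.1 hx).2.symm
        exact_mod_cast this.trans (hD y)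
    _ ≤ D * (D * ‖v‖ ^ 2) := by
        rw [← Finset.mul_sum]
        have := lp.sum_rpow_le_norm_rpow (p := 2) (by simp) v
          (s.biUnion (fun x => G.neighborFinset x))
        simp only [ENNReal.toReal_ofNat, Real.rpow_two] at this
        gcongr
    _ = (D * ‖v‖) ^ 2 := by ring

/-- The adjacency operator `(Δ v)(x) = ∑_{y ~ x} v(y)` on `ℓ²(V)`, for a graph with
bounded degrees. -/
noncomputable def adjacencyOperator {V : Type} (G : SimpleGraph V) [G.LocallyFinite]
    (hG : ∃ D : ℕ, ∀ x, G.degree x ≤ D) : EllTwo V →L[ℂ] EllTwo V :=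
  LinearMap.mkContinuousOfExistsBound
    { toFun := fun v => ⟨fun x => ∑ y ∈ G.neighborFinset x, v y,
        memℓp_gen' (sum_sq_neighbors_le G _ hG.choose_spec v)⟩
      map_add' := fun u v => by
        ext x
        exact Finset.sum_add_distrib
      map_smul' := fun c v => by
        ext x
        simp [Finset.mul_sum] }
    ⟨hG.choose, fun v => lp.norm_le_of_forall_sum_le (by simp) (by positivity)
      (sum_sq_neighbors_le G _ hG.choose_spec v)⟩

theorem adjacencyOperator_apply {V : Type} (G : SimpleGraph V) [G.LocallyFinite]
    (hG : ∃ D : ℕ, ∀ x, G.degree x ≤ D) (v : EllTwo V) (x : V) :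
    adjacencyOperator G hG v x = ∑ y ∈ G.neighborFinset x, v y := rfl

theorem adjacencyOperator_isSelfAdjoint {V : Type} (G : SimpleGraph V) [G.LocallyFinite]
    (hG : ∃ D : ℕ, ∀ x, G.degree x ≤ D) : IsSelfAdjoint (adjacencyOperator G hG) := by
  classical
  rw [ContinuousLinearMap.isSelfAdjoint_iff']
  refine lp.ext_continuousLinearMap (by simp) fun y => ?_
  ext x
  have h := lp.inner_single_left (𝕜 := ℂ) (G := fun _ : V => ℂ) x (1 : ℂ)
    (ContinuousLinearMap.adjoint (adjacencyOperator G hG) (lp.single 2 y (1 : ℂ)))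
  rw [ContinuousLinearMap.adjoint_inner_right, lp.inner_single_right] at h
  simp only [adjacencyOperator_apply, lp.coeFn_single] at h
  simp only [ContinuousLinearMap.comp_apply, lp.singleContinuousLinearMap_apply,
    adjacencyOperator_apply, lp.coeFn_single]
  simp only [RCLike.inner_apply, map_one, mul_one, one_mul] at h
  rw [← h]
  simp [Pi.single_apply, apply_ite, SimpleGraph.adj_comm]

/-! ### Spectral measures and the absolutely continuous spectrum -/

/-- The positive linear functional `f ↦ ⟨ψ, f(T) ψ⟩` on compactly supported continuous functions,
for a bounded self-adjoint operator `T`. -/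
noncomputable def spectralFunctional {H : Type} [NormedAddCommGroup H] [InnerProductSpace ℂ H]
    [CompleteSpace H] (T : H →L[ℂ] H) (_hT : IsSelfAdjoint T) (ψ : H) : C_c(ℝ, ℝ) →ₚ[ℝ] ℝ :=
  PositiveLinearMap.mk₀
    { toFun := fun f => (inner ℂ ψ (cfc (fun x : ℝ => f x) T ψ)).re
      map_add' := fun f g => by
        have := cfc_add (R := ℝ) T (fun x => f x) (fun x => g x)
          f.continuous.continuousOn g.continuous.continuousOn
        simp [this]
      map_smul' := fun c f => by
        have := cfc_smul (R := ℝ) c (fun x => f x) T f.continuous.continuousOn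
        simp only [smul_eq_mul] at this
        simp [this, inner_smul_right_eq_smul] }
    (fun f hf => by
      have h : 0 ≤ cfc (fun x : ℝ => f x) T := cfc_nonneg fun x _ => hf x
      exact ((ContinuousLinearMap.nonneg_iff_isPositive _).1 h).re_inner_nonneg_right ψ)

/-- The spectral measure of `T` at `ψ`: the (unique) finite Borel measure `μ` on `ℝ` with
`∫ f dμ = ⟨ψ, f(T) ψ⟩` for all compactly supported continuous `f`. -/
noncomputable def spectralMeasure {H : Type} [NormedAddCommGroup H] [InnerProductSpace ℂ H]
    [CompleteSpace H] (T : H →L[ℂ] H) (hT : IsSelfAdjoint T) (ψ : H) : Measure ℝ :=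
  RealRMK.rieszMeasure (spectralFunctional T hT ψ)

/-- The absolutely continuous subspace of `T`: all `ψ` whose spectral measure is absolutely
continuous with respect to Lebesgue measure. It is a closed subspace which reduces `T`. -/
def acSubspace {H : Type} [NormedAddCommGroup H] [InnerProductSpace ℂ H]
    [CompleteSpace H] (T : H →L[ℂ] H) (hT : IsSelfAdjoint T) : Set H :=
  {ψ | spectralMeasure T hT ψ ≪ volume}

/-- The absolutely continuous spectrum of `T`: the spectrum of the restriction of `T` to its
absolutely continuous subspace, i.e. the set of those `E` for which `T - E` is not a bijection of
this (closed, invariant) subspace onto itself. The spectrum is real because `T` is self-adjoint. -/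
def acSpectrum {H : Type} [NormedAddCommGroup H] [InnerProductSpace ℂ H]
    [CompleteSpace H] (T : H →L[ℂ] H) (hT : IsSelfAdjoint T) : Set ℝ :=
  {E | ¬ Set.BijOn (fun ψ => T ψ - (E : ℂ) • ψ) (acSubspace T hT) (acSubspace T hT)}

/-! ### The trees with line segments, their Green's functions and energy sets -/

namespace FibTree

/-- The substitution matrix with labels `0, …, L`: a vertex of label `0` has `K` children of
label `0` and one of label `1`, a vertex of label `0 < p < L` has one child of label `p + 1`, a
vertex of label `L` has one child of label `0`. -/
def substMatrix (K L : ℕ) : Matrix (Fin (L + 1)) (Fin (L + 1)) ℕ :=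
  Matrix.of fun p q =>
    if p.val = 0 ∧ q.val = 0 then K
    else if q.val = p.val + 1 then 1
    else if p.val = L ∧ q.val = 0 then 1
    else 0

/-- The vertex set of the forest, the disjoint union of the trees with root labels `0, …, L`. -/
abbrev Forest (K L : ℕ) : Type := SubstForest (substMatrix K L)

/-- The root of the tree with root label `p`. -/
def root (K L : ℕ) (p : Fin (L + 1)) : Forest K L := ⟨p, SubstTree.root p⟩

/-- The adjacency operator `Δ` on `ℓ²` of the forest. -/
noncomputable def adj (K L : ℕ) : EllTwo (Forest K L) →L[ℂ] EllTwo (Forest K L) :=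
  adjacencyOperator (substForestGraph (substMatrix K L)) (substForestGraph_degree_le _)

theorem adj_isSelfAdjoint (K L : ℕ) : IsSelfAdjoint (adj K L) :=
  adjacencyOperator_isSelfAdjoint _ _

open Classical in
/-- The unit vector `|x⟩` of `ℓ²` at the vertex `x`. -/
noncomputable def ket {K L : ℕ} (x : Forest K L) : EllTwo (Forest K L) :=
  lp.single 2 x (1 : ℂ)

/-- The Green's function `Γ^{(p)}_z = ⟨0^{(p)}| (Δ - z)⁻¹ |0^{(p)}⟩` at the root of the tree with
root label `p`, used for `Im z > 0` (where `Δ - z` is invertible). -/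
noncomputable def green (K L : ℕ) (p : Fin (L + 1)) (z : ℂ) : ℂ :=
  inner ℂ (ket (root K L p))
    (Ring.inverse (adj K L - z • (1 : EllTwo (Forest K L) →L[ℂ] EllTwo (Forest K L)))
      (ket (root K L p)))

/-- The boundary value `Γ^{(p)}_E = lim_{η ↓ 0} Γ^{(p)}_{E + iη}` (if the limit exists). -/
noncomputable def greenBdry (K L : ℕ) (p : Fin (L + 1)) (E : ℝ) : ℂ :=
  limUnder (𝓝[>] (0 : ℝ)) fun η : ℝ => green K L p ((E : ℂ) + η * Complex.I)

/-- `I_p^{K,L}`: the energies where `Γ^{(p)}_E` exists and has positive imaginary part. -/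
def energySet (K L : ℕ) (p : Fin (L + 1)) : Set ℝ :=
  {E | ∃ g : ℂ, Tendsto (fun η : ℝ => green K L p ((E : ℂ) + η * Complex.I))
    (𝓝[>] (0 : ℝ)) (𝓝 g) ∧ 0 < g.im}

/-- The adjacency matrix `Δ_d` of the finite line with `d` vertices. -/
def lineMatrix (d : ℕ) : Matrix (Fin d) (Fin d) ℝ :=
  Matrix.of fun i j => if i.val + 1 = j.val ∨ j.val + 1 = i.val then 1 else 0

/-- `𝓔_L`: the eigenvalues of the matrices `Δ_1, …, Δ_L`. -/
def exceptionalSet (L : ℕ) : Set ℝ :=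
  ⋃ d ∈ Set.Icc 1 L, {E | Module.End.HasEigenvalue (Matrix.toLin' (lineMatrix d)) E}

/-- `I^{K,L} = I_0^{K,L} \ 𝓔_L`. -/
def mainSet (K L : ℕ) : Set ℝ := energySet K L 0 \ exceptionalSet L

end FibTree

/-- `A` is a non-empty union of finitely many (non-empty, bounded) open intervals. -/
def IsNonemptyFiniteUnionOfIoo (A : Set ℝ) : Prop :=
  ∃ s : Finset (ℝ × ℝ), s.Nonempty ∧ (∀ q ∈ s, q.1 < q.2) ∧ A = ⋃ q ∈ s, Set.Ioo q.1 q.2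

/-! Deleting the root of a tree leaves copies of trees of the forest, so the root Green's functions
solve `(z + ∑_q S_pq Γ_q) Γ_p = -1` (`green_recursion`). Following the labels backwards, `0, L, L-1,
…, 1`, gives `Γ_{-j} = -x_{j-1} / x_j` with `x_j = S_j(z) + S_{j-1}(z) Γ_0` and `S_j` the rescaled
Chebyshev polynomials. The equation at label `0` then becomes the cubic `greenCubic` for `Γ_0`. For
`Im z > 0` the system has only one solution in the upper half-plane, since its right-hand side
strictly contracts a hyperbolic distance (`recursion_unique`); hence `Γ_0` is the root of the cubic
in the upper half-plane.

At real `E` the cubic has real coefficients and discriminant `S_L(E)² Q(E)`, with `Q` the polynomial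
`energyDiscr`. Where this is negative there is a nonreal root, it is simple, and the implicit
function theorem continues `Γ_0` analytically through `E`. Thus `I_0` is the set where `S_L ≠ 0` and
`Q < 0` (`mem_energySet_zero_iff`), an open set with finite frontier, and (i) follows. Completing a
square shows `Q(E) < 0` as soon as `E² < 3(K+1)`, which gives (iii); for `K = L = 1` one has `Q =
4E² - 27`, which gives (iv).

For (ii), the imaginary part of `⟨ψ, (T - E - iη)⁻¹ ψ⟩` bounds the spectral mass of the ball of
radius `η` around `E`. By a covering theorem, finite boundary values exclude mass on Lebesgue null
sets, and zero boundary values exclude mass altogether. On `I_0` the root vector therefore has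
absolutely continuous spectral measure, which charges every open subset of `I_0`
(`mem_acSpectrum_of_mem_closure`). Off `I_0` and a finite set `branchSet`, all limit points of the
root Green's functions are real; the resolvent identities for subtrees carry this to every vertex
(`exists_real_limit_opResolvent`). As the vertex vectors span a dense subspace, all spectral
measures vanish there, and the finite set is invisible to absolutely continuous vectors
(`notMem_acSpectrum`). -/

/-! ### Spectral measures of a bounded self-adjoint operator -/

section SpectralMeasure

variable {H : Type} [NormedAddCommGroup H] [InnerProductSpace ℂ H] [CompleteSpace H]
  {T : H →L[ℂ] H}

instance spectralMeasure_regular (hT : IsSelfAdjoint T) (ψ : H) :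
    (spectralMeasure T hT ψ).Regular := by
  unfold spectralMeasure; infer_instance

theorem cfc_inner_left (f : ℝ → ℝ) (φ ψ : H) :
    inner ℂ (cfc f T φ) ψ = inner ℂ φ (cfc f T ψ) := by
  have h : IsSelfAdjoint (cfc f T) := cfc_predicate f T
  rw [← ContinuousLinearMap.adjoint_inner_left, ContinuousLinearMap.isSelfAdjoint_iff'.1 h]

theorem cfc_mul_apply (f g : ℝ → ℝ) (hf : Continuous f) (hg : Continuous g) (ψ : H) :
    cfc (fun x => f x * g x) T ψ = cfc f T (cfc g T ψ) := by
  rw [cfc_mul f g T hf.continuousOn hg.continuousOn]; rfl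

theorem inner_cfc_nonneg (f : ℝ → ℝ) (hf : ∀ x ∈ spectrum ℝ T, 0 ≤ f x) (ψ : H) :
    0 ≤ (inner ℂ ψ (cfc f T ψ)).re := by
  have h : 0 ≤ cfc f T := cfc_nonneg hf
  exact ((ContinuousLinearMap.nonneg_iff_isPositive _).1 h).re_inner_nonneg_right ψ

theorem inner_cfc_mono {f g : ℝ → ℝ} (hf : Continuous f) (hg : Continuous g)
    (hfg : ∀ x ∈ spectrum ℝ T, f x ≤ g x) (ψ : H) :
    (inner ℂ ψ (cfc f T ψ)).re ≤ (inner ℂ ψ (cfc g T ψ)).re := by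
  have h := inner_cfc_nonneg (T := T) (fun x => g x - f x) 
    (fun x hx => sub_nonneg.2 (hfg x hx)) ψ
  rw [cfc_sub g f T hg.continuousOn hf.continuousOn] at h
  simpa [inner_sub_right] using h

theorem inner_cfc_const (hT : IsSelfAdjoint T) (c : ℝ) (ψ : H) :
    (inner ℂ ψ (cfc (fun _ : ℝ => c) T ψ)).re = c * ‖ψ‖ ^ 2 := by
  rw [cfc_const c T hT, Algebra.algebraMap_eq_smul_one, smul_apply,
    one_apply_eq_self, inner_smul_right_eq_smul, Complex.real_smul,
    Complex.re_ofReal_mul, inner_self_eq_norm_sq_to_K]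
  norm_cast

theorem norm_cfc_apply_sq {f : ℝ → ℝ} (hf : Continuous f) (ψ : H) :
    ‖cfc f T ψ‖ ^ 2 = (inner ℂ ψ (cfc (fun x => f x * f x) T ψ)).re := by
  rw [cfc_mul_apply f f hf hf, ← cfc_inner_left, inner_self_eq_norm_sq_to_K]
  norm_cast

theorem cfc_id_sub_const (hT : IsSelfAdjoint T) (E : ℝ) (ψ : H) :
    cfc (fun x : ℝ => x - E) T ψ = T ψ - (E : ℂ) • ψ := by
  rw [cfc_sub (fun x : ℝ => x) (fun _ => E) T, cfc_id' ℝ T hT, cfc_const E T hT,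
    Algebra.algebraMap_eq_smul_one]
  simp

/-- If `f ≤ 1` has support in `V`, the functional at `f` is bounded by the measure of `V`. -/
theorem inner_cfc_le_spectralMeasure (hT : IsSelfAdjoint T) (ψ : H) (f : C_c(ℝ, ℝ))
    (hf : ∀ x, 0 ≤ f x ∧ f x ≤ 1) {V : Set ℝ} (hV : tsupport f ⊆ V) :
    ENNReal.ofReal (inner ℂ ψ (cfc (fun x : ℝ => f x) T ψ)).re ≤ spectralMeasure T hT ψ V :=
  RealRMK.le_rieszMeasure_tsupport_subset _ hf hV

theorem spectralMeasure_le_inner_cfc (hT : IsSelfAdjoint T) (ψ : H) (f : C_c(ℝ, ℝ))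
    (hf : ∀ x, 0 ≤ f x) {K : Set ℝ} (hK : IsCompact K) (hfK : ∀ x ∈ K, f x = 1) :
    spectralMeasure T hT ψ K ≤
      ENNReal.ofReal (inner ℂ ψ (cfc (fun x : ℝ => f x) T ψ)).re :=
  RealRMK.rieszMeasure_le_of_eq_one _ hf hK hfK

theorem exists_bump {K U : Set ℝ} (hK : IsCompact K) (hU : IsOpen U) (hKU : K ⊆ U) :
    ∃ f : C_c(ℝ, ℝ), (∀ x ∈ K, f x = 1) ∧ tsupport f ⊆ U ∧ ∀ x, 0 ≤ f x ∧ f x ≤ 1 := by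
  obtain ⟨f, h1, h2, h3⟩ := exists_continuousMap_one_of_isCompact_subset_isOpen hK hU hKU
  exact ⟨⟨f, hasCompactSupport_def.mpr h2⟩, fun x hx => h1 hx, h3.1, fun x => h3.2 x⟩

theorem spectralMeasure_univ_le (hT : IsSelfAdjoint T) (ψ : H) :
    spectralMeasure T hT ψ univ ≤ ENNReal.ofReal (‖ψ‖ ^ 2) := by
  rw [isOpen_univ.measure_eq_iSup_isCompact]
  refine iSup₂_le fun K _ => iSup_le fun hK => ?_
  obtain ⟨f, h1, -, h3⟩ := exists_bump hK isOpen_univ (subset_univ K)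
  refine (spectralMeasure_le_inner_cfc hT ψ f (fun x => (h3 x).1) hK h1).trans ?_
  refine ENNReal.ofReal_le_ofReal ?_
  have := inner_cfc_mono (T := T) f.continuous continuous_const (fun x _ => (h3 x).2) ψ
  simpa [inner_cfc_const hT] using this

instance spectralMeasure_isFiniteMeasure (hT : IsSelfAdjoint T) (ψ : H) :
    IsFiniteMeasure (spectralMeasure T hT ψ) :=
  ⟨(spectralMeasure_univ_le hT ψ).trans_lt ENNReal.ofReal_lt_top⟩

/-- Comparison of spectral measures through the functional calculus. -/
theorem spectralMeasure_le_of_inner_cfc_le (hT : IsSelfAdjoint T) {ψ : H} {ν : Measure ℝ}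
    [ν.OuterRegular]
    (h : ∀ (f : C_c(ℝ, ℝ)) (V : Set ℝ), (∀ x, 0 ≤ f x ∧ f x ≤ 1) → IsOpen V → tsupport f ⊆ V →
      ENNReal.ofReal (inner ℂ ψ (cfc (fun x : ℝ => f x) T ψ)).re ≤ ν V) :
    spectralMeasure T hT ψ ≤ ν := by
  intro A
  -- Outer regularity of `ν` reduces to open sets, inner regularity of the spectral measure to
  -- compact subsets; a bump function separates the two.
  rw [A.measure_eq_iInf_isOpen ν]
  refine le_iInf₂ fun U hAU => le_iInf fun hU => (measure_mono hAU).trans ?_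
  rw [hU.measure_eq_iSup_isCompact]
  refine iSup₂_le fun K hKU => iSup_le fun hK => ?_
  obtain ⟨f, h1, h2, h3⟩ := exists_bump hK hU hKU
  exact (spectralMeasure_le_inner_cfc hT ψ f (fun x => (h3 x).1) hK h1).trans (h f U h3 hU h2)

/-- The parallelogram law for the positive form `⟨·, f(T) ·⟩`, with the term at `φ - ψ` dropped.
This crude bound makes the vectors with vanishing spectral mass on `A` a closed subspace. -/
theorem spectralMeasure_add_le (hT : IsSelfAdjoint T) (φ ψ : H) (A : Set ℝ) :
    spectralMeasure T hT (φ + ψ) A ≤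
      2 * spectralMeasure T hT φ A + 2 * spectralMeasure T hT ψ A := by
  have key : spectralMeasure T hT (φ + ψ) ≤
      (2 : NNReal) • spectralMeasure T hT φ + (2 : NNReal) • spectralMeasure T hT ψ := by
    have i1 : ((2 : NNReal) • spectralMeasure T hT φ +
      (2 : NNReal) • spectralMeasure T hT ψ).OuterRegular := by infer_instance
    refine spectralMeasure_le_of_inner_cfc_le hT fun f V hf hV hfV => ?_
    have h1 := inner_cfc_le_spectralMeasure hT φ f hf hfV
    have h2 := inner_cfc_le_spectralMeasure hT ψ f hf hfV
    have h3 := inner_cfc_nonneg (T := T) (fun x => f x) (fun x _ => (hf x).1) (φ - ψ)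
    have h4 := inner_cfc_nonneg (T := T) (fun x => f x) (fun x _ => (hf x).1) φ
    have h5 := inner_cfc_nonneg (T := T) (fun x => f x) (fun x _ => (hf x).1) ψ
    set B := cfc (fun x : ℝ => f x) T
    have h6 : (inner ℂ (φ + ψ) (B (φ + ψ))).re + (inner ℂ (φ - ψ) (B (φ - ψ))).re =
        2 * (inner ℂ φ (B φ)).re + 2 * (inner ℂ ψ (B ψ)).re := by
      simp only [map_add, map_sub, inner_add_left, inner_add_right, inner_sub_left,
        inner_sub_right, Complex.add_re, Complex.sub_re]
      ring
    calc ENNReal.ofReal (inner ℂ (φ + ψ) (B (φ + ψ))).re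
        ≤ ENNReal.ofReal (2 * (inner ℂ φ (B φ)).re + 2 * (inner ℂ ψ (B ψ)).re) :=
          ENNReal.ofReal_le_ofReal (by linarith)
      _ = 2 * ENNReal.ofReal (inner ℂ φ (B φ)).re + 2 * ENNReal.ofReal (inner ℂ ψ (B ψ)).re := by
          rw [ENNReal.ofReal_add (by positivity) (by positivity),
            ENNReal.ofReal_mul (by norm_num), ENNReal.ofReal_mul (by norm_num)]
          simp
      _ ≤ _ := by
          simp only [Measure.add_apply, Measure.smul_apply, ENNReal.smul_def, smul_eq_mul]
          push_cast
          gcongr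
  have := key A
  simpa [Measure.add_apply, Measure.smul_apply, ENNReal.smul_def] using this

/-- Because `⟨g(T)ψ, f(T) g(T)ψ⟩ = ⟨ψ, (g² f)(T) ψ⟩`. It shows that the functional calculus
preserves absolute continuity. -/
theorem spectralMeasure_cfc_apply_le (hT : IsSelfAdjoint T) {g : ℝ → ℝ} (hg : Continuous g)
    {C : NNReal} (hC : ∀ x ∈ spectrum ℝ T, g x ^ 2 ≤ C) (ψ : H) (A : Set ℝ) :
    spectralMeasure T hT (cfc g T ψ) A ≤ C * spectralMeasure T hT ψ A := by
  have key : spectralMeasure T hT (cfc g T ψ) ≤ C • spectralMeasure T hT ψ := by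
    refine spectralMeasure_le_of_inner_cfc_le hT fun f V hf hV hfV => ?_
    have h1 := inner_cfc_le_spectralMeasure hT ψ f hf hfV
    have h2 : (inner ℂ (cfc g T ψ) (cfc (fun x => f x) T (cfc g T ψ))).re ≤
        C * (inner ℂ ψ (cfc (fun x => f x) T ψ)).re := by
      rw [cfc_inner_left, ← cfc_mul_apply (fun x => f x) g f.continuous hg,
        ← cfc_mul_apply g (fun x => f x * g x) hg (f.continuous.mul hg)]
      have := inner_cfc_mono (T := T) (f := fun x => g x * (f x * g x))
        (g := fun x => (C : ℝ) * f x) (hg.mul (f.continuous.mul hg))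
        (continuous_const.mul f.continuous)
        (fun x hx => by nlinarith [hC x hx, (hf x).1]) ψ
      rw [cfc_const_mul (C : ℝ) (fun x => f x) T f.continuous.continuousOn] at this
      simpa [inner_smul_right_eq_smul] using this
    refine (ENNReal.ofReal_le_ofReal h2).trans ?_
    rw [ENNReal.ofReal_mul C.coe_nonneg]
    simp only [Measure.smul_apply, ENNReal.smul_def, smul_eq_mul, ENNReal.ofReal_coe_nnreal]
    gcongr
  exact key A

/-- The squared norm of `f(T)ψ` is the integral of `f²` against the spectral measure. -/
theorem cfc_apply_eq_zero_of_spectralMeasure_eq_zero (hT : IsSelfAdjoint T) {f : C_c(ℝ, ℝ)}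
    {ψ : H} {U : Set ℝ} (hU : spectralMeasure T hT ψ U = 0) (hf : Function.support f ⊆ U) :
    cfc (fun x => f x) T ψ = 0 := by
  have h : ‖cfc (fun x => f x) T ψ‖ ^ 2 = ∫ x, f x * f x ∂(spectralMeasure T hT ψ) := by
    rw [norm_cfc_apply_sq (f := fun x => f x) f.continuous]
    exact (RealRMK.integral_rieszMeasure (spectralFunctional T hT ψ) (f * f)).symm
  have h0 : ∫ x, f x * f x ∂(spectralMeasure T hT ψ) = 0 := by
    refine integral_eq_zero_of_ae ?_
    have : ∀ᵐ x ∂(spectralMeasure T hT ψ), x ∉ U := measure_eq_zero_iff_ae_notMem.1 hU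
    filter_upwards [this] with x hx
    have : f x = 0 := by
      by_contra h
      exact hx (hf h)
    simp [this]
  rw [h0] at h
  simpa using h

/-- The vectors whose spectral measure vanishes on `A`. -/
def spectralNullSubspace (hT : IsSelfAdjoint T) (A : Set ℝ) : Submodule ℂ H where
  carrier := {ψ | spectralMeasure T hT ψ A = 0}
  add_mem' {φ ψ} hφ hψ := by
    have h := spectralMeasure_add_le hT φ ψ A
    rw [mem_ofPred_eq] at hφ hψ
    rw [hφ, hψ] at h
    simpa using h
  zero_mem' := by
    refine le_antisymm ((measure_mono (subset_univ _)).trans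
      ((spectralMeasure_univ_le hT 0).trans (by simp))) bot_le
  smul_mem' c ψ hψ := by
    have key : spectralMeasure T hT (c • ψ) ≤ (‖c‖₊ ^ 2) • spectralMeasure T hT ψ := by
      refine spectralMeasure_le_of_inner_cfc_le hT fun f V hf hV hfV => ?_
      have h1 := inner_cfc_le_spectralMeasure hT ψ f hf hfV
      have h2 : (inner ℂ (c • ψ) (cfc (fun x => f x) T (c • ψ))).re =
          ((‖c‖₊ ^ 2 : NNReal) : ℝ) * (inner ℂ ψ (cfc (fun x => f x) T ψ)).re := by
        rw [map_smul, inner_smul_left, inner_smul_right, ← mul_assoc,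
          Complex.conj_mul']
        norm_cast
        rw [Complex.re_ofReal_mul]
        simp
      rw [h2, ENNReal.ofReal_mul (NNReal.coe_nonneg _)]
      simp only [Measure.smul_apply, ENNReal.smul_def, smul_eq_mul, ENNReal.ofReal_coe_nnreal]
      gcongr
    have h := key A
    rw [mem_ofPred_eq] at hψ ⊢
    simpa [Measure.smul_apply, hψ] using h

theorem mem_spectralNullSubspace (hT : IsSelfAdjoint T) (A : Set ℝ) (ψ : H) :
    ψ ∈ spectralNullSubspace hT A ↔ spectralMeasure T hT ψ A = 0 := Iff.rfl

theorem isClosed_spectralNullSubspace (hT : IsSelfAdjoint T) (A : Set ℝ) :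
    IsClosed (spectralNullSubspace hT A : Set H) := by
  refine isClosed_of_closure_subset fun ψ hψ => ?_
  rw [SetLike.mem_coe, mem_spectralNullSubspace, ← nonpos_iff_eq_zero]
  refine ENNReal.le_of_forall_pos_le_add fun ε hε _ => ?_
  -- The total mass at `ψ - φ` is at most `‖ψ - φ‖² < ε / 2`, and `spectralMeasure_add_le` doubles
  -- it.
  obtain ⟨φ, hφ, hd⟩ := Metric.mem_closure_iff.1 hψ (√(ε / 2)) (by positivity)
  have h := spectralMeasure_add_le hT φ (ψ - φ) A
  rw [add_sub_cancel, (mem_spectralNullSubspace hT A φ).1 hφ] at h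
  refine h.trans ?_
  have h2 : spectralMeasure T hT (ψ - φ) A ≤ ENNReal.ofReal (ε / 2) := by
    refine (measure_mono (subset_univ _)).trans ((spectralMeasure_univ_le hT _).trans ?_)
    refine ENNReal.ofReal_le_ofReal ?_
    rw [dist_eq_norm] at hd
    calc ‖ψ - φ‖ ^ 2 ≤ √(ε / 2) ^ 2 := by gcongr
      _ = _ := Real.sq_sqrt (by positivity)
  simp only [mul_zero, zero_add]
  calc 2 * spectralMeasure T hT (ψ - φ) A ≤ 2 * ENNReal.ofReal (ε / 2) := by gcongr
    _ = ENNReal.ofReal (2 * (ε / 2)) := by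
        rw [ENNReal.ofReal_mul (by norm_num)]; simp
    _ = ε := by rw [mul_div_cancel₀ _ (by norm_num)]; simp

/-- The absolutely continuous subspace as a submodule. -/
def acSubmodule (hT : IsSelfAdjoint T) : Submodule ℂ H :=
  ⨅ A ∈ {A : Set ℝ | volume A = 0}, spectralNullSubspace hT A

theorem coe_acSubmodule (hT : IsSelfAdjoint T) :
    (acSubmodule hT : Set H) = acSubspace T hT := by
  ext ψ
  simp only [acSubmodule, SetLike.mem_coe, Submodule.mem_iInf, mem_spectralNullSubspace,
    acSubspace, mem_ofPred_eq]
  exact ⟨fun h A hA => h A hA, fun h A hA => h hA⟩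

theorem isClosed_acSubmodule (hT : IsSelfAdjoint T) : IsClosed (acSubmodule hT : Set H) := by
  simp only [acSubmodule, Submodule.coe_iInf]
  exact isClosed_biInter fun A _ => isClosed_spectralNullSubspace hT A

theorem cfc_apply_mem_acSubmodule (hT : IsSelfAdjoint T) {g : ℝ → ℝ} (hg : Continuous g)
    {ψ : H} (hψ : ψ ∈ acSubmodule hT) : cfc g T ψ ∈ acSubmodule hT := by
  obtain ⟨C, hC⟩ := (spectrum.isCompact (𝕜 := ℝ) T).exists_bound_of_continuousOn
    (hg.pow 2).continuousOn
  have hC' : ∀ x ∈ spectrum ℝ T, g x ^ 2 ≤ C.toNNReal := fun x hx =>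
    (le_abs_self _).trans ((hC x hx).trans (Real.le_coe_toNNReal C))
  simp only [acSubmodule, Submodule.mem_iInf, mem_spectralNullSubspace] at hψ ⊢
  intro A hA
  have h := spectralMeasure_cfc_apply_le hT hg hC' ψ A
  rwa [hψ A hA, mul_zero, nonpos_iff_eq_zero] at h

theorem spectralMeasure_cfc_apply_compl_tsupport (hT : IsSelfAdjoint T) {g : ℝ → ℝ}
    (hg : Continuous g) (ψ : H) : spectralMeasure T hT (cfc g T ψ) (tsupport g)ᶜ = 0 := by
  rw [(isClosed_tsupport g).isOpen_compl.measure_eq_iSup_isCompact]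
  refine nonpos_iff_eq_zero.1 (iSup₂_le fun K hKU => iSup_le fun hK => ?_)
  obtain ⟨f, h1, h2, h3⟩ := exists_bump hK (isClosed_tsupport g).isOpen_compl hKU
  refine (spectralMeasure_le_inner_cfc hT _ f (fun x => (h3 x).1) hK h1).trans ?_
  rw [← cfc_mul_apply (fun x => f x) g f.continuous hg]
  have : (fun x => f x * g x) = fun _ => 0 := by
    funext x
    by_cases hx : x ∈ tsupport g
    · rw [image_eq_zero_of_notMem_tsupport fun h => h2 h hx, zero_mul]
    · rw [image_eq_zero_of_notMem_tsupport hx, mul_zero]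
  rw [this, cfc_const_zero]
  simp

end SpectralMeasure

/-! ### The resolvent and the boundary behaviour of its diagonal elements -/

section Resolvent

set_option linter.unusedSectionVars false

variable {H : Type} [NormedAddCommGroup H] [InnerProductSpace ℂ H] [CompleteSpace H]
  {T : H →L[ℂ] H}

/-- The resolvent `(T - z)⁻¹`. -/
noncomputable def opResolvent (T : H →L[ℂ] H) (z : ℂ) : H →L[ℂ] H :=
  Ring.inverse (T - z • (1 : H →L[ℂ] H))

theorem isUnit_sub_smul_one {z : ℂ} (hz : z ∉ spectrum ℂ T) :
    IsUnit (T - z • (1 : H →L[ℂ] H)) := by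
  have h := (spectrum.notMem_iff.1 hz).neg
  rwa [neg_sub, Algebra.algebraMap_eq_smul_one] at h

theorem notMem_spectrum_of_im_pos (hT : IsSelfAdjoint T) {z : ℂ} (hz : 0 < z.im) :
    z ∉ spectrum ℂ T := fun h => hz.ne' (hT.im_eq_zero_of_mem_spectrum h)

theorem opResolvent_apply_sub {z : ℂ} (hz : z ∉ spectrum ℂ T) (ψ : H) :
    opResolvent T z (T ψ - z • ψ) = ψ :=
  DFunLike.congr_fun (Ring.inverse_mul_cancel _ (isUnit_sub_smul_one hz)) ψ

theorem sub_opResolvent_apply {z : ℂ} (hz : z ∉ spectrum ℂ T) (ψ : H) :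
    T (opResolvent T z ψ) - z • opResolvent T z ψ = ψ :=
  DFunLike.congr_fun (Ring.mul_inverse_cancel _ (isUnit_sub_smul_one hz)) ψ

theorem inner_apply_self_im (hT : IsSelfAdjoint T) (φ : H) : (inner ℂ (T φ) φ).im = 0 := by
  have h : (starRingEnd ℂ) (inner ℂ (T φ) φ) = inner ℂ (T φ) φ := by
    rw [inner_conj_symm, ← ContinuousLinearMap.adjoint_inner_left,
      ContinuousLinearMap.isSelfAdjoint_iff'.1 hT]
  exact Complex.conj_eq_iff_im.1 h

/-- With `φ = (T - z)⁻¹ψ`, the inner product is `⟨(T - z)φ, φ⟩`, and `⟨Tφ, φ⟩` is real. -/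
theorem im_inner_opResolvent (hT : IsSelfAdjoint T) {z : ℂ} (hz : 0 < z.im) (ψ : H) :
    (inner ℂ ψ (opResolvent T z ψ)).im = z.im * ‖opResolvent T z ψ‖ ^ 2 := by
  have h := sub_opResolvent_apply (notMem_spectrum_of_im_pos hT hz) ψ
  set φ := opResolvent T z ψ
  have hn : inner ℂ φ φ = ((‖φ‖ ^ 2 : ℝ) : ℂ) := by
    rw [inner_self_eq_norm_sq_to_K]; push_cast; rfl
  rw [← h, inner_sub_left, inner_smul_left, Complex.sub_im, inner_apply_self_im hT, hn,
    Complex.mul_im, Complex.ofReal_im, Complex.ofReal_re]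
  simp

theorem norm_opResolvent_apply_le (hT : IsSelfAdjoint T) {z : ℂ} (hz : 0 < z.im) (ψ : H) :
    z.im * ‖opResolvent T z ψ‖ ≤ ‖ψ‖ := by
  rcases (norm_nonneg (opResolvent T z ψ)).eq_or_lt with h | h
  · rw [← h]; simp
  · refine le_of_mul_le_mul_right ?_ h
    calc z.im * ‖opResolvent T z ψ‖ * ‖opResolvent T z ψ‖
        = (inner ℂ ψ (opResolvent T z ψ)).im := by rw [im_inner_opResolvent hT hz]; ring
      _ ≤ ‖inner ℂ ψ (opResolvent T z ψ)‖ := (le_abs_self _).trans (Complex.abs_im_le_norm _)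
      _ ≤ _ := norm_inner_le_norm _ _

theorem add_mul_I_im (E η : ℝ) : ((E : ℂ) + η * Complex.I).im = η := by simp

/-- If `ψ` lies in the range of `T - E`, the imaginary part of the diagonal resolvent element
at `ψ` vanishes at `E`. -/
theorem tendsto_im_inner_opResolvent_of_range (hT : IsSelfAdjoint T) {E : ℝ} {φ ψ : H}
    (h : T φ - (E : ℂ) • φ = ψ) :
    Tendsto (fun η : ℝ => (inner ℂ ψ (opResolvent T ((E : ℂ) + η * Complex.I) ψ)).im)
      (𝓝[>] (0 : ℝ)) (𝓝 0) := by
  have hlim : Tendsto (fun η : ℝ => η * (2 * ‖φ‖) ^ 2) (𝓝[>] (0 : ℝ)) (𝓝 0) := by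
    have : Tendsto (fun η : ℝ => η * (2 * ‖φ‖) ^ 2) (𝓝 (0 : ℝ)) (𝓝 (0 * (2 * ‖φ‖) ^ 2)) :=
      tendsto_id.mul_const _
    rw [zero_mul] at this
    exact this.mono_left nhdsWithin_le_nhds
  refine squeeze_zero' ?_ ?_ hlim
  all_goals
    filter_upwards [self_mem_nhdsWithin] with η hη
    have hz : 0 < ((E : ℂ) + η * Complex.I).im := by rw [add_mul_I_im]; exact hη
    rw [im_inner_opResolvent hT hz, add_mul_I_im]
  · have : 0 < η := hη
    positivity
  · have hη' : 0 < η := hη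
    -- At `z = E + iη` this yields `(T - z)⁻¹ψ = φ + iη (T - z)⁻¹φ`, of norm at most `2‖φ‖`; the
    -- imaginary part is then at most `η (2‖φ‖)²`.
    have h1 := opResolvent_apply_sub (notMem_spectrum_of_im_pos hT hz) φ
    have h2 : T φ - ((E : ℂ) + η * Complex.I) • φ = ψ - (η * Complex.I) • φ := by
      rw [← h, add_smul]; abel
    rw [h2, map_sub, map_smul, sub_eq_iff_eq_add] at h1
    have h3 := norm_opResolvent_apply_le hT hz φ
    rw [add_mul_I_im] at h3
    rw [h1]
    gcongr
    refine (norm_add_le _ _).trans ?_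
    rw [norm_smul, norm_mul, Complex.norm_I, Complex.norm_real, Real.norm_of_nonneg hη'.le]
    linarith

/-- Take a bump `f` equal to `1` on the ball and supported in the doubled ball, and write `ψ = (T -
E - iη)φ`. Then `⟨ψ, f(T)ψ⟩` is the form of `((x - E)² + η²) f(x)` at `φ`, and this function is at
most `(4 + 1) η²`; finally `η ‖φ‖²` is the imaginary part in question. -/
theorem spectralMeasure_closedBall_le (hT : IsSelfAdjoint T) (ψ : H) (E : ℝ) {η : ℝ}
    (hη : 0 < η) :
    spectralMeasure T hT ψ (Metric.closedBall E η) ≤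
      ENNReal.ofReal (5 * η * (inner ℂ ψ (opResolvent T ((E : ℂ) + η * Complex.I) ψ)).im) := by
  obtain ⟨f, h1, h2, h3⟩ := exists_bump (isCompact_closedBall E η)
    (Metric.isOpen_ball (x := E) (ε := 2 * η)) (Metric.closedBall_subset_ball (by linarith))
  refine (spectralMeasure_le_inner_cfc hT ψ f (fun x => (h3 x).1)
    (isCompact_closedBall E η) h1).trans (ENNReal.ofReal_le_ofReal ?_)
  have hz : 0 < ((E : ℂ) + η * Complex.I).im := by rw [add_mul_I_im]; exact hη
  rw [im_inner_opResolvent hT hz, add_mul_I_im]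
  have h4 := sub_opResolvent_apply (notMem_spectrum_of_im_pos hT hz) ψ
  set φ := opResolvent T ((E : ℂ) + η * Complex.I) ψ
  set B := cfc (fun x : ℝ => f x) T with hB
  set S := cfc (fun x : ℝ => x - E) T with hS
  have hc : Continuous fun x : ℝ => x - E := by fun_prop
  have hψ : ψ = S φ - (η * Complex.I) • φ := by
    rw [hS, cfc_id_sub_const hT, ← h4, add_smul]; abel
  -- This makes the cross terms in the expansion of `⟨ψ, Bψ⟩` cancel.
  have hcross : inner ℂ (S φ) (B φ) = inner ℂ φ (B (S φ)) := by
    rw [hS, hB, cfc_inner_left, ← cfc_mul_apply _ (fun x => f x) hc f.continuous,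
      ← cfc_mul_apply (fun x => f x) _ f.continuous hc]
    simp_rw [mul_comm]
  have hmain : (inner ℂ ψ (B ψ)).re =
      (inner ℂ (S φ) (B (S φ))).re + η ^ 2 * (inner ℂ φ (B φ)).re := by
    rw [hψ]
    simp only [map_sub, map_smul, inner_sub_left, inner_sub_right, inner_smul_left,
      inner_smul_right, hcross]
    simp only [map_mul, Complex.conj_ofReal, Complex.conj_I]
    simp only [Complex.sub_re, Complex.sub_im, Complex.mul_re, Complex.mul_im, Complex.I_re, Complex.I_im,
      Complex.ofReal_re, Complex.ofReal_im, Complex.neg_re, Complex.neg_im]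
    ring
  have h5 : (inner ℂ (S φ) (B (S φ))).re ≤ 4 * η ^ 2 * ‖φ‖ ^ 2 := by
    rw [hS, hB, cfc_inner_left, ← cfc_mul_apply (fun x => f x) _ f.continuous hc,
      ← cfc_mul_apply _ (fun x => f x * (x - E)) hc (f.continuous.mul hc),
      ← inner_cfc_const hT]
    refine inner_cfc_mono (hc.mul (f.continuous.mul hc)) continuous_const (fun x _ => ?_) φ
    change (x - E) * (f x * (x - E)) ≤ 4 * η ^ 2
    by_cases hx : x ∈ Metric.ball E (2 * η)
    · rw [Metric.mem_ball, Real.dist_eq, abs_lt] at hx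
      nlinarith [(h3 x).1, (h3 x).2, mul_nonneg (sub_nonneg.2 (h3 x).2) (sq_nonneg (x - E))]
    · rw [image_eq_zero_of_notMem_tsupport fun h => hx (h2 h)]
      have : 0 ≤ 4 * η ^ 2 := by positivity
      simpa using this
  have h6 : (inner ℂ φ (B φ)).re ≤ 1 * ‖φ‖ ^ 2 := by
    rw [← inner_cfc_const hT]
    exact inner_cfc_mono f.continuous continuous_const (fun x _ => (h3 x).2) φ
  rw [hmain]
  nlinarith [sq_nonneg η]

/-- Around each point of `s` there are arbitrarily small closed balls whose spectral mass is at most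
`5C` times their length; the Besicovitch covering theorem passes this to `s`. -/
theorem spectralMeasure_le_mul_volume (hT : IsSelfAdjoint T) (ψ : H) {s : Set ℝ} {C : NNReal}
    (h : ∀ E ∈ s, ∃ᶠ η : ℝ in 𝓝[>] 0,
      (inner ℂ ψ (opResolvent T ((E : ℂ) + η * Complex.I) ψ)).im ≤ C) :
    spectralMeasure T hT ψ s ≤ ((5 * C : NNReal) : ENNReal) * volume s := by
  have hm := (Besicovitch.vitaliFamily (spectralMeasure T hT ψ)).measure_le_of_frequently_le
    ((5 * C : NNReal) • (volume : Measure ℝ)) (Measure.AbsolutelyContinuous.refl _) s ?_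
  · exact hm
  intro E hE
  refine (Besicovitch.tendsto_filterAt (spectralMeasure T hT ψ) E).frequently ?_
  refine ((h E hE).and_eventually self_mem_nhdsWithin).mono fun η hη => ?_
  obtain ⟨h1, h2⟩ := hη
  have h2' : 0 < η := h2
  refine (spectralMeasure_closedBall_le hT ψ E h2').trans ?_
  rw [Measure.smul_apply, Real.volume_closedBall, ENNReal.smul_def, smul_eq_mul,
    ← ENNReal.ofReal_coe_nnreal, ← ENNReal.ofReal_mul (NNReal.coe_nonneg _)]
  refine ENNReal.ofReal_le_ofReal ?_
  push_cast
  nlinarith [C.coe_nonneg, mul_nonneg h2'.le C.coe_nonneg]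

theorem spectralMeasure_eq_zero_of_tendsto_zero (hT : IsSelfAdjoint T) (ψ : H) {s : Set ℝ}
    (h : ∀ E ∈ s, Tendsto (fun η : ℝ =>
      (inner ℂ ψ (opResolvent T ((E : ℂ) + η * Complex.I) ψ)).im) (𝓝[>] 0) (𝓝 0)) :
    spectralMeasure T hT ψ s = 0 := by
  -- Bounded pieces have finite volume, so the bound `5C · volume` tends to `0` with `C`.
  have hs : s = ⋃ n : ℕ, s ∩ Metric.ball 0 n := by
    rw [← inter_iUnion, Metric.iUnion_ball_nat, inter_univ]
  rw [hs]
  refine measure_iUnion_null fun n => nonpos_iff_eq_zero.1 ?_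
  have hv : volume (s ∩ Metric.ball 0 (n : ℝ)) ≠ ⊤ :=
    (measure_mono inter_subset_right).trans_lt (measure_ball_lt_top) |>.ne
  have hb : ∀ C : NNReal, 0 < C → spectralMeasure T hT ψ (s ∩ Metric.ball 0 n) ≤
      ((5 * C : NNReal) : ENNReal) * volume (s ∩ Metric.ball 0 (n : ℝ)) := fun C hC =>
    spectralMeasure_le_mul_volume hT ψ fun E hE =>
      ((h E hE.1).eventually (eventually_le_nhds (by exact_mod_cast hC))).frequently
  have hlim : Tendsto (fun C : NNReal => ((5 * C : NNReal) : ENNReal) *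
      volume (s ∩ Metric.ball 0 (n : ℝ))) (𝓝[>] 0) (𝓝 0) := by
    have h1 : Tendsto (fun C : NNReal => ((5 * C : NNReal) : ENNReal)) (𝓝 0)
        (𝓝 ((5 * 0 : NNReal) : ENNReal)) :=
      (ENNReal.continuous_coe.comp (continuous_const.mul continuous_id)).tendsto 0
    have h2 := ENNReal.Tendsto.mul_const (b := volume (s ∩ Metric.ball 0 (n : ℝ))) h1
      (Or.inr hv)
    simp only [mul_zero, ENNReal.coe_zero, zero_mul] at h2
    exact h2.mono_left nhdsWithin_le_nhds
  refine ge_of_tendsto hlim ?_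
  filter_upwards [self_mem_nhdsWithin] with C hC using hb C hC

/-- The set is exhausted by the parts on which the boundary value is controlled by an integer `n`,
and each part has mass at most `5n` times volume zero. -/
theorem spectralMeasure_eq_zero_of_volume_eq_zero (hT : IsSelfAdjoint T) (ψ : H) {s : Set ℝ}
    (hs : volume s = 0)
    (h : ∀ E ∈ s, ∃ c, Tendsto (fun η : ℝ =>
      (inner ℂ ψ (opResolvent T ((E : ℂ) + η * Complex.I) ψ)).im) (𝓝[>] 0) (𝓝 c)) :
    spectralMeasure T hT ψ s = 0 := by
  have hsub : s ⊆ ⋃ n : ℕ, {E ∈ s | ∃ᶠ η : ℝ in 𝓝[>] 0,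
      (inner ℂ ψ (opResolvent T ((E : ℂ) + η * Complex.I) ψ)).im ≤ ((n : NNReal) : ℝ)} := by
    intro E hE
    obtain ⟨c, hc⟩ := h E hE
    obtain ⟨n, hn⟩ := exists_nat_gt c
    exact mem_iUnion.2 ⟨n, hE, (hc.eventually (eventually_le_nhds hn)).frequently⟩
  refine measure_mono_null hsub (measure_iUnion_null fun n => nonpos_iff_eq_zero.1 ?_)
  refine (spectralMeasure_le_mul_volume hT ψ (C := n) fun E hE => hE.2).trans ?_
  rw [measure_mono_null (fun E hE => hE.1) hs, mul_zero]

/-- A continuous function agreeing with `1 / (x - E)` off the set where `f = 1`. -/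
theorem exists_continuous_sub_mul_eq (E : ℝ) {f : ℝ → ℝ} (hf : Continuous f)
    {δ : ℝ} (hδ : 0 < δ) (hE : ∀ x ∈ Metric.closedBall E δ, f x = 1) :
    ∃ k : ℝ → ℝ, Continuous k ∧ ∀ x, (x - E) * k x = 1 - f x := by
  refine ⟨fun x => (1 - f x) / (x - E), ?_, fun x => ?_⟩
  · rw [continuous_iff_continuousAt]
    intro x
    by_cases hx : x = E
    · subst hx
      refine (continuousAt_const (y := (0 : ℝ))).congr ?_
      filter_upwards [Metric.closedBall_mem_nhds x hδ] with y hy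
      rw [hE y hy]; simp
    · exact ContinuousAt.div (by fun_prop) (by fun_prop) (sub_ne_zero.2 hx)
  · by_cases hx : x = E
    · subst hx
      rw [hE x (Metric.mem_closedBall_self hδ.le)]; simp
    · exact mul_div_cancel₀ _ (sub_ne_zero.2 hx)

theorem sub_smul_cfc_apply (hT : IsSelfAdjoint T) {E : ℝ} {f k : ℝ → ℝ} (hf : Continuous f)
    (hk : Continuous k) (h : ∀ x, (x - E) * k x = 1 - f x) (ψ : H) :
    T (cfc k T ψ) - (E : ℂ) • cfc k T ψ = ψ - cfc f T ψ := by
  rw [← cfc_id_sub_const hT, ← cfc_mul_apply _ _ (by fun_prop) hk]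
  simp_rw [h]
  rw [cfc_sub (fun _ => (1 : ℝ)) f T continuousOn_const hf.continuousOn,
    cfc_const_one ℝ T hT]
  rfl

theorem cfc_apply_sub_smul (hT : IsSelfAdjoint T) {E : ℝ} {f k : ℝ → ℝ} (hf : Continuous f)
    (hk : Continuous k) (h : ∀ x, (x - E) * k x = 1 - f x) (ψ : H) :
    cfc k T (T ψ - (E : ℂ) • ψ) = ψ - cfc f T ψ := by
  rw [← cfc_id_sub_const hT, ← cfc_mul_apply _ _ hk (by fun_prop)]
  simp_rw [mul_comm (k _), h]
  rw [cfc_sub (fun _ => (1 : ℝ)) f T continuousOn_const hf.continuousOn,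
    cfc_const_one ℝ T hT]
  rfl

/-! ### The absolutely continuous spectrum -/

/-- Choose a bump `f` near `E` supported in `U` and `k` with `(x - E) k(x) = 1 - f(x)`. Since `f(T)`
kills the absolutely continuous subspace, `k(T)` inverts `T - E` on it. -/
theorem notMem_acSpectrum (hT : IsSelfAdjoint T) {U : Set ℝ} (hU : IsOpen U)
    (h : ∀ ψ ∈ acSubmodule hT, spectralMeasure T hT ψ U = 0) {E : ℝ} (hE : E ∈ U) :
    E ∉ acSpectrum T hT := by
  obtain ⟨δ, hδ, hball⟩ := Metric.isOpen_iff.1 hU E hE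
  obtain ⟨f, h1, h2, -⟩ := exists_bump (isCompact_closedBall E (δ / 2))
    (Metric.isOpen_ball (x := E) (ε := δ)) (Metric.closedBall_subset_ball (by linarith))
  obtain ⟨k, hk, hkf⟩ := exists_continuous_sub_mul_eq E (f := fun x => f x) f.continuous
    (half_pos hδ) h1
  have hf0 : ∀ ψ ∈ acSubmodule hT, cfc (fun x => f x) T ψ = 0 := fun ψ hψ =>
    cfc_apply_eq_zero_of_spectralMeasure_eq_zero hT (h ψ hψ)
      ((subset_tsupport f).trans (h2.trans hball))
  rw [acSpectrum, mem_ofPred_eq, not_not, ← coe_acSubmodule]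
  refine ⟨fun ψ hψ => ?_, fun φ hφ ψ hψ he => ?_, fun ψ hψ => ⟨cfc k T ψ, ?_, ?_⟩⟩
  · change T ψ - (E : ℂ) • ψ ∈ acSubmodule hT
    rw [← cfc_id_sub_const hT]
    exact cfc_apply_mem_acSubmodule hT (by fun_prop) hψ
  · have e1 := cfc_apply_sub_smul hT (f := fun x => f x) f.continuous hk hkf φ
    have e2 := cfc_apply_sub_smul hT (f := fun x => f x) f.continuous hk hkf ψ
    have e : T φ - (E : ℂ) • φ = T ψ - (E : ℂ) • ψ := he
    rw [e, e2] at e1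
    rwa [hf0 φ hφ, hf0 ψ hψ, sub_zero, sub_zero, eq_comm] at e1
  · exact cfc_apply_mem_acSubmodule hT hk hψ
  · have e1 := sub_smul_cfc_apply hT (f := fun x => f x) f.continuous hk hkf ψ
    rwa [hf0 ψ hψ, sub_zero] at e1

theorem norm_sub_smul_cfc_apply_le (hT : IsSelfAdjoint T) {f : ℝ → ℝ} (hf : Continuous f)
    {E δ : ℝ} (hδ : 0 ≤ δ) (h : tsupport f ⊆ Metric.ball E δ) (ψ : H) :
    ‖T (cfc f T ψ) - (E : ℂ) • cfc f T ψ‖ ≤ δ * ‖cfc f T ψ‖ := by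
  have hc : Continuous fun x => (x - E) * f x := by fun_prop
  rw [← cfc_id_sub_const hT, ← cfc_mul_apply _ _ (by fun_prop) hf]
  refine abs_le_of_sq_le_sq' ?_ (by positivity) |>.2
  rw [mul_pow, norm_cfc_apply_sq hc, norm_cfc_apply_sq hf]
  have h2 := inner_cfc_mono (T := T) (f := fun x => (x - E) * f x * ((x - E) * f x))
    (g := fun x => δ ^ 2 * (f x * f x)) (hc.mul hc) (by fun_prop) (fun x _ => ?_) ψ
  · rw [cfc_const_mul (δ ^ 2) (fun x => f x * f x) T (hf.mul hf).continuousOn] at h2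
    refine h2.trans_eq ?_
    rw [smul_apply, inner_smul_right_eq_smul, Complex.real_smul, Complex.re_ofReal_mul]
  · by_cases hx : x ∈ tsupport f
    · have := h hx
      rw [Metric.mem_ball, Real.dist_eq] at this
      have h3 : (x - E) ^ 2 ≤ δ ^ 2 := by
        rw [← sq_abs (x - E)]
        gcongr
      calc (x - E) * f x * ((x - E) * f x) = (x - E) ^ 2 * (f x * f x) := by ring
        _ ≤ δ ^ 2 * (f x * f x) := mul_le_mul_of_nonneg_right h3 (mul_self_nonneg _)
    · rw [image_eq_zero_of_notMem_tsupport hx]; simp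

/-- The bounded inverse theorem on the absolutely continuous subspace, which is complete because it
is closed. -/
theorem exists_norm_le_of_notMem_acSpectrum (hT : IsSelfAdjoint T) {E : ℝ}
    (hE : E ∉ acSpectrum T hT) :
    ∃ C : ℝ, 0 ≤ C ∧ ∀ ψ ∈ acSubmodule hT, ‖ψ‖ ≤ C * ‖T ψ - (E : ℂ) • ψ‖ := by
  rw [acSpectrum, mem_ofPred_eq, not_not, ← coe_acSubmodule] at hE
  have : CompleteSpace (acSubmodule hT) := (isClosed_acSubmodule hT).completeSpace_coe
  let A : H →L[ℂ] H := T - (E : ℂ) • ContinuousLinearMap.id ℂ H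
  let S : acSubmodule hT →L[ℂ] acSubmodule hT :=
    (A ∘L (acSubmodule hT).subtypeL).codRestrict (acSubmodule hT) fun ψ => hE.mapsTo ψ.2
  have hinj : Function.Injective S := fun φ ψ h =>
    Subtype.ext (hE.injOn φ.2 ψ.2 (congrArg Subtype.val h))
  have hsurj : Function.Surjective S := fun ψ => by
    obtain ⟨φ, hφ, h⟩ := hE.surjOn ψ.2
    exact ⟨⟨φ, hφ⟩, Subtype.ext h⟩
  let e := ContinuousLinearEquiv.ofBijective S (LinearMap.ker_eq_bot.2 hinj)
    (LinearMap.range_eq_top.2 hsurj)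
  refine ⟨‖(e.symm : acSubmodule hT →L[ℂ] acSubmodule hT)‖, norm_nonneg _, fun ψ hψ => ?_⟩
  have h := (e.symm : acSubmodule hT →L[ℂ] acSubmodule hT).le_opNorm (e ⟨ψ, hψ⟩)
  rw [ContinuousLinearEquiv.coe_coe, e.symm_apply_apply] at h
  exact h

/-- A bump `f` supported in `I` close to `E` makes `f(T)φ` a nonzero absolutely continuous
approximate eigenvector, which contradicts a bounded inverse. -/
theorem mem_acSpectrum_of_mem_closure (hT : IsSelfAdjoint T) {I : Set ℝ} (hI : IsOpen I) {φ : H}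
    (h : ∀ E ∈ I, ∃ c, 0 < c ∧ Tendsto (fun η : ℝ =>
      (inner ℂ φ (opResolvent T ((E : ℂ) + η * Complex.I) φ)).im) (𝓝[>] 0) (𝓝 c))
    {E : ℝ} (hE : E ∈ closure I) : E ∈ acSpectrum T hT := by
  by_contra hn
  obtain ⟨C, hC0, hC⟩ := exists_norm_le_of_notMem_acSpectrum hT hn
  -- Any `δ` with `C * δ < 1` serves: the approximate eigenvector has error at most `δ‖ψ‖`.
  set δ : ℝ := (C + 1)⁻¹
  have hδ : 0 < δ := by positivity
  obtain ⟨E', hE', hd⟩ := Metric.mem_closure_iff.1 hE δ hδ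
  rw [dist_comm] at hd
  obtain ⟨r, hr, hball⟩ := Metric.isOpen_iff.1 (hI.inter (Metric.isOpen_ball (x := E) (ε := δ)))
    E' ⟨hE', hd⟩
  obtain ⟨f, h1, h2, h3⟩ := exists_bump (isCompact_closedBall E' (r / 2))
    (Metric.isOpen_ball (x := E') (ε := r)) (Metric.closedBall_subset_ball (by linarith))
  have hsupp := h2.trans hball
  set ψ := cfc (fun x => f x) T φ with hψdef
  have hψ : ψ ∈ acSubmodule hT := by
    simp only [acSubmodule, Submodule.mem_iInf, mem_spectralNullSubspace]
    intro N hN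
    have hsub : N ⊆ (N ∩ I) ∪ (tsupport f)ᶜ := fun x hx => by
      by_cases hxI : x ∈ tsupport f
      · exact Or.inl ⟨hx, (hsupp hxI).1⟩
      · exact Or.inr hxI
    refine measure_mono_null hsub (measure_union_null ?_
      (spectralMeasure_cfc_apply_compl_tsupport hT f.continuous φ))
    have hle := spectralMeasure_cfc_apply_le hT (g := fun x => f x) (C := 1) f.continuous
      (fun x _ => by
        have := h3 x
        rw [NNReal.coe_one]
        nlinarith) φ (N ∩ I)
    rw [spectralMeasure_eq_zero_of_volume_eq_zero hT φ (measure_mono_null inter_subset_left hN)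
      (fun x hx => (h x hx.2).imp fun c hc => hc.2), mul_zero, nonpos_iff_eq_zero] at hle
    exact hle
  -- If `f(T)φ` vanished, `φ = (T - E') k(T)φ` would lie in the range of `T - E'`, so its boundary
  -- value at `E'` would have imaginary part zero.
  have hψ0 : ψ ≠ 0 := by
    intro h0
    obtain ⟨k, hk, hkf⟩ := exists_continuous_sub_mul_eq E' (f := fun x => f x) f.continuous
      (half_pos hr) h1
    have e := sub_smul_cfc_apply hT (f := fun x => f x) f.continuous hk hkf φ
    rw [← hψdef, h0, sub_zero] at e
    obtain ⟨c, hc, hlim⟩ := h E' hE'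
    exact hc.ne (tendsto_nhds_unique (tendsto_im_inner_opResolvent_of_range hT e) hlim)
  have e1 := hC ψ hψ
  have e2 := norm_sub_smul_cfc_apply_le hT (f := fun x => f x) f.continuous hδ.le
    (fun x hx => (hsupp hx).2) φ
  have hpos : 0 < ‖ψ‖ := norm_pos_iff.2 hψ0
  have e3 : C * δ < 1 := by
    rw [← div_eq_mul_inv, div_lt_one (by positivity)]
    linarith
  have e4 : ‖ψ‖ ≤ C * (δ * ‖ψ‖) := e1.trans (mul_le_mul_of_nonneg_left e2 hC0)
  nlinarith

end Resolvent

/-! ### The adjacency operator of a substitution forest and its resolvent -/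

namespace SubstTree

variable {ι : Type} {S : Matrix ι ι ℕ}

theorem sub_injective {p : ι} (q : ι) (i : Fin (S p q)) :
    Function.Injective (sub q i : SubstTree S q → SubstTree S p) := by
  intro x y h
  cases h
  rfl

/-- The neighbours of a vertex inside its tree. -/
def nbrs {p : ι} (a : SubstTree S p) : Set (SubstTree S p) := {b | a.IsChild b ∨ b.IsChild a}

theorem IsChild.ne {p : ι} {a b : SubstTree S p} (h : a.IsChild b) : a ≠ b := by
  induction h with
  | base q i => exact fun h => by cases h
  | step q i h ih => exact fun h => ih (sub_injective q i h)

theorem nbrs_root (p : ι) : (root p : SubstTree S p).nbrs =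
    range fun c : (Σ q : ι, Fin (S p q)) => (sub c.1 c.2 (root c.1) : SubstTree S p) := by
  ext b
  constructor
  · rintro (h | h)
    · cases h with
      | base q i => exact ⟨⟨q, i⟩, rfl⟩
    · cases h
  · rintro ⟨c, rfl⟩
    exact Or.inl (.base c.1 c.2)

theorem nbrs_sub {p : ι} (q : ι) (i : Fin (S p q)) (x : SubstTree S q) :
    (sub q i x : SubstTree S p).nbrs =
      {b | b = root p ∧ x = root q} ∪ sub q i '' x.nbrs := by
  ext b
  constructor
  · rintro (h | h)
    · cases h with
      | step _ _ h => exact Or.inr ⟨_, Or.inl h, rfl⟩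
    · cases h with
      | base => exact Or.inl ⟨rfl, rfl⟩
      | step _ _ h => exact Or.inr ⟨_, Or.inr h, rfl⟩
  · rintro (⟨rfl, rfl⟩ | ⟨y, h | h, rfl⟩)
    · exact Or.inr (.base q i)
    · exact Or.inl (.step q i h)
    · exact Or.inr (.step q i h)

theorem finite_nbrs [Fintype ι] {p : ι} (a : SubstTree S p) : a.nbrs.Finite :=
  (finite_of_encard_le_coe (encard_children_le S a)).union
    (finite_of_encard_le_coe (s := {b : SubstTree S p | b.IsChild a}) (k := 1) (by exact_mod_cast encard_parents_le S a))

end SubstTree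

section Forest

set_option linter.unusedSectionVars false

variable {ι : Type} [Fintype ι] (S : Matrix ι ι ℕ)

/-- The adjacency operator of the forest. -/
noncomputable abbrev forestAdj : EllTwo (SubstForest S) →L[ℂ] EllTwo (SubstForest S) :=
  adjacencyOperator (substForestGraph S) (substForestGraph_degree_le S)

variable {S}

/-- The root of a tree of the forest. -/
abbrev forestRoot (p : ι) : SubstForest S := ⟨p, SubstTree.root p⟩

open Classical in
/-- The unit vector at a vertex. -/
noncomputable def site (x : SubstForest S) : EllTwo (SubstForest S) := lp.single 2 x (1 : ℂ)

open Classical in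
theorem site_apply (x y : SubstForest S) : site x y = if y = x then 1 else 0 := by
  simp [site, Pi.single_apply]

theorem inner_site (x : SubstForest S) (v : EllTwo (SubstForest S)) :
    inner ℂ (site x) v = v x := by
  classical
  rw [site, lp.inner_single_left]; simp

theorem forestAdj_apply (v : EllTwo (SubstForest S)) {p : ι} (a : SubstTree S p) :
    forestAdj S v ⟨p, a⟩ = ∑ᶠ b ∈ a.nbrs, v ⟨p, b⟩ := by
  rw [adjacencyOperator_apply, ← finsum_mem_coe_finset]
  have h : (((substForestGraph S).neighborFinset ⟨p, a⟩ : Finset (SubstForest S)) :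
      Set (SubstForest S)) = (fun b => (⟨p, b⟩ : SubstForest S)) '' a.nbrs := by
    ext y
    rw [Finset.mem_coe, SimpleGraph.mem_neighborFinset, substForestGraph,
      SimpleGraph.fromRel_adj]
    constructor
    · rintro ⟨-, ⟨p', a', b, h1, h2, h3⟩ | ⟨p', a', b, h1, h2, h3⟩⟩
      · cases h1
        exact ⟨b, Or.inl h3, h2.symm⟩
      · cases h2
        exact ⟨a', Or.inr h3, h1.symm⟩
    · rintro ⟨b, h | h, rfl⟩
      · exact ⟨fun e => h.ne (by cases e; rfl), Or.inl ⟨p, a, b, rfl, rfl, h⟩⟩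
      · exact ⟨fun e => h.ne (by cases e; rfl), Or.inr ⟨p, b, a, rfl, rfl, h⟩⟩
  rw [h, finsum_mem_image]
  exact fun b _ c _ h => by cases h; rfl

theorem forestAdj_apply_root (v : EllTwo (SubstForest S)) (p : ι) :
    forestAdj S v (forestRoot p) =
      ∑ c : (Σ q : ι, Fin (S p q)), v ⟨p, SubstTree.sub c.1 c.2 (SubstTree.root c.1)⟩ := by
  rw [forestAdj_apply, SubstTree.nbrs_root, finsum_mem_range, finsum_eq_sum_of_fintype]
  rintro ⟨q, i⟩ ⟨q', i'⟩ h
  cases h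
  rfl

open Classical in
theorem forestAdj_apply_sub (v : EllTwo (SubstForest S)) (p q : ι) (i : Fin (S p q))
    (x : SubstTree S q) :
    forestAdj S v ⟨p, SubstTree.sub q i x⟩ =
      (if x = SubstTree.root q then v (forestRoot p) else 0) +
        ∑ᶠ y ∈ x.nbrs, v ⟨p, SubstTree.sub q i y⟩ := by
  have hset : {b : SubstTree S p | b = SubstTree.root p ∧ x = SubstTree.root q} ⊆
      {SubstTree.root p} := fun b hb => hb.1
  rw [forestAdj_apply, SubstTree.nbrs_sub, finsum_mem_union,
    finsum_mem_image (SubstTree.sub_injective q i).injOn]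
  · congr 1
    split_ifs with h
    · have : {b : SubstTree S p | b = SubstTree.root p ∧ x = SubstTree.root q} =
        {SubstTree.root p} := by ext; simp [h]
      rw [this, finsum_mem_singleton]
    · simp [h]
  · rw [Set.disjoint_left]
    rintro _ ⟨rfl, -⟩ ⟨y, -, h⟩
    cases h
  · exact (finite_singleton _).subset hset
  · exact x.finite_nbrs.image _

/-- The vector on the forest obtained by moving the restriction of `u` to the tree with root label
`q` to the subtree of the `i`-th child of label `q` of the root with label `p`. -/
noncomputable def graft {p q : ι} (i : Fin (S p q)) (u : EllTwo (SubstForest S)) :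
    EllTwo (SubstForest S) :=
  ⟨Function.extend (fun x : SubstTree S q => (⟨p, SubstTree.sub q i x⟩ : SubstForest S))
    (fun x => u ⟨q, x⟩) 0, by
    have hinj : Function.Injective
        (fun x : SubstTree S q => (⟨p, SubstTree.sub q i x⟩ : SubstForest S)) :=
      fun x y h => by cases h; rfl
    refine (memℓp_gen_iff (by simp)).2 ((hinj.summable_iff fun y hy => ?_).1 ?_)
    · rw [Function.extend_apply' _ _ _ (by simpa using hy)]
      simp
    · have h := (memℓp_gen_iff (by simp)).1 (lp.memℓp u)
      have h2 := h.comp_injective (i := fun x : SubstTree S q => (⟨q, x⟩ : SubstForest S))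
        (fun x y h => by cases h; rfl)
      refine h2.congr fun x => ?_
      simp [hinj.extend_apply]⟩

theorem graft_apply_sub {p q : ι} (i : Fin (S p q)) (u : EllTwo (SubstForest S))
    (x : SubstTree S q) : graft i u ⟨p, SubstTree.sub q i x⟩ = u ⟨q, x⟩ := by
  have hinj : Function.Injective
      (fun x : SubstTree S q => (⟨p, SubstTree.sub q i x⟩ : SubstForest S)) :=
    fun x y h => by cases h; rfl
  exact hinj.extend_apply (fun x => u ⟨q, x⟩) 0 x

theorem graft_apply_of_ne {p q : ι} (i : Fin (S p q)) (u : EllTwo (SubstForest S))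
    {y : SubstForest S} (hy : ∀ x, y ≠ ⟨p, SubstTree.sub q i x⟩) : graft i u y = 0 := by
  refine Function.extend_apply' (fun x : SubstTree S q => u ⟨q, x⟩)
    (0 : SubstForest S → ℂ) y ?_
  rintro ⟨x, rfl⟩
  exact hy x rfl

theorem graft_apply_root {p q : ι} (i : Fin (S p q)) (u : EllTwo (SubstForest S)) (p' : ι) :
    graft i u (forestRoot p') = 0 :=
  graft_apply_of_ne i u fun x h => by cases h

theorem graft_sub_smul {p q : ι} (i : Fin (S p q)) (u v : EllTwo (SubstForest S)) (z : ℂ) :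
    graft i (u - z • v) = graft i u - z • graft i v := by
  ext y
  by_cases h : ∃ x, y = ⟨p, SubstTree.sub q i x⟩
  · obtain ⟨x, rfl⟩ := h
    simp only [lp.coeFn_sub, lp.coeFn_smul, Pi.sub_apply, Pi.smul_apply, graft_apply_sub]
  · push Not at h
    simp only [lp.coeFn_sub, lp.coeFn_smul, Pi.sub_apply, Pi.smul_apply, graft_apply_of_ne i _ h]
    simp

theorem graft_site {p q : ι} (i : Fin (S p q)) (x : SubstTree S q) :
    graft i (site ⟨q, x⟩) = site ⟨p, SubstTree.sub q i x⟩ := by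
  ext y
  by_cases h : ∃ x, y = ⟨p, SubstTree.sub q i x⟩
  · obtain ⟨x', rfl⟩ := h
    rw [graft_apply_sub, site_apply, site_apply]
    congr 1
    refine propext ⟨fun h => by cases h; rfl, fun h => by cases h; rfl⟩
  · push Not at h
    rw [graft_apply_of_ne i _ h, site_apply, if_neg (h x)]

/-- A grafted tree keeps its internal edges; the single new edge joins its root to the root above
it. -/
theorem forestAdj_graft {p q : ι} (i : Fin (S p q)) (u : EllTwo (SubstForest S)) :
    forestAdj S (graft i u) =
      graft i (forestAdj S u) + u (forestRoot q) • site (forestRoot p) := by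
  classical
  ext ⟨p', y⟩
  rw [lp.coeFn_add, Pi.add_apply, lp.coeFn_smul, Pi.smul_apply, site_apply, smul_eq_mul]
  by_cases hp : p' = p
  · subst hp
    cases y with
    | root =>
      rw [forestAdj_apply_root, graft_apply_root, zero_add, if_pos rfl, mul_one,
        Finset.sum_eq_single ⟨q, i⟩, graft_apply_sub]
      · rintro ⟨q', i'⟩ - hne
        refine graft_apply_of_ne i u fun x h => hne ?_
        cases h
        rfl
      · simp
    | sub q' i' x =>
      rw [forestAdj_apply_sub, graft_apply_root, ite_self, zero_add,
        if_neg (fun h => by cases h), mul_zero, add_zero]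
      by_cases hc : (⟨q', i'⟩ : Σ q : ι, Fin (S p' q)) = ⟨q, i⟩
      · cases hc
        rw [graft_apply_sub, forestAdj_apply]
        simp_rw [graft_apply_sub]
      · have hne : ∀ (a : SubstTree S q') (b : SubstTree S q),
            (⟨p', SubstTree.sub q' i' a⟩ : SubstForest S) ≠ ⟨p', SubstTree.sub q i b⟩ :=
          fun a b h => hc (by cases h; rfl)
        rw [graft_apply_of_ne i _ (hne x)]
        refine finsum_mem_eq_zero_of_forall_eq_zero fun b _ => ?_
        exact graft_apply_of_ne i u (hne b)
  · have hne : ∀ (a : SubstTree S p') (b : SubstTree S q),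
        (⟨p', a⟩ : SubstForest S) ≠ ⟨p, SubstTree.sub q i b⟩ :=
      fun a b h => hp (by cases h; rfl)
    rw [graft_apply_of_ne i _ (hne y), if_neg (fun h => hp (by cases h; rfl)), mul_zero, zero_add,
      forestAdj_apply]
    exact finsum_mem_eq_zero_of_forall_eq_zero fun b _ => graft_apply_of_ne i u (hne b)

theorem forestAdj_site_root (p : ι) :
    forestAdj S (site (forestRoot p)) = ∑ c : (Σ q : ι, Fin (S p q)),
      site ⟨p, SubstTree.sub c.1 c.2 (SubstTree.root c.1)⟩ := by
  classical
  ext ⟨p', y⟩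
  rw [lp.coeFn_sum, Finset.sum_apply]
  simp_rw [site_apply]
  cases y with
  | root =>
    rw [forestAdj_apply_root, Finset.sum_eq_zero, Finset.sum_eq_zero]
    · exact fun c _ => if_neg fun h => by cases h
    · exact fun c _ => (site_apply _ _).trans (if_neg fun h => by cases h)
  | sub q i x =>
    rw [forestAdj_apply_sub, finsum_mem_eq_zero_of_forall_eq_zero, add_zero, site_apply]
    · by_cases h : p' = p ∧ x = SubstTree.root q
      · obtain ⟨rfl, rfl⟩ := h
        rw [if_pos rfl, if_pos rfl, Finset.sum_eq_single ⟨q, i⟩, if_pos rfl]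
        · rintro ⟨q', i'⟩ - hne
          exact if_neg fun h => hne (by cases h; rfl)
        · simp
      · rw [Finset.sum_eq_zero]
        · split_ifs with h1 h2
          · exact absurd ⟨by cases h2; rfl, h1⟩ h
          · rfl
          · rfl
        · exact fun c _ => if_neg fun h' => h (by cases h'; exact ⟨rfl, rfl⟩)
    · exact fun b _ => (site_apply _ _).trans (if_neg fun h => by cases h)

/-! ### Resolvent entries of a tree in terms of those of its subtrees -/

variable {z : ℂ}

/-- By `forestAdj_graft`, the grafted resolvent vector solves the resolvent equation up to a
multiple of the unit vector at the root. -/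
theorem opResolvent_site_sub (hz : z ∉ spectrum ℂ (forestAdj S)) {p q : ι} (i : Fin (S p q))
    (x : SubstTree S q) :
    opResolvent (forestAdj S) z (site ⟨p, SubstTree.sub q i x⟩) =
      graft i (opResolvent (forestAdj S) z (site ⟨q, x⟩)) -
        opResolvent (forestAdj S) z (site ⟨q, x⟩) (forestRoot q) •
          opResolvent (forestAdj S) z (site (forestRoot p)) := by
  have h := opResolvent_apply_sub hz (graft i (opResolvent (forestAdj S) z (site ⟨q, x⟩)))
  rw [forestAdj_graft, add_sub_right_comm, ← graft_sub_smul, sub_opResolvent_apply hz,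
    graft_site, map_add, map_smul] at h
  rw [← h, add_sub_cancel_right]

theorem smul_opResolvent_site_root (hz : z ∉ spectrum ℂ (forestAdj S)) (p : ι) :
    (z + ∑ c : (Σ q : ι, Fin (S p q)),
        opResolvent (forestAdj S) z (site (forestRoot c.1)) (forestRoot c.1)) •
      opResolvent (forestAdj S) z (site (forestRoot p)) =
    (∑ c : (Σ q : ι, Fin (S p q)),
      graft c.2 (opResolvent (forestAdj S) z (site (forestRoot c.1)))) - site (forestRoot p) := by
  have h := opResolvent_apply_sub hz (site (forestRoot p))
  rw [forestAdj_site_root, map_sub, map_sum, map_smul] at h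
  simp_rw [opResolvent_site_sub hz] at h
  rw [Finset.sum_sub_distrib, ← Finset.sum_smul] at h
  rw [sub_sub, sub_eq_iff_eq_add] at h
  rw [h, add_smul]
  abel

/-- The identity `smul_opResolvent_site_root` read at the root, where every graft vanishes. -/
theorem green_recursion (hz : z ∉ spectrum ℂ (forestAdj S)) (p : ι) :
    (z + ∑ q, (S p q : ℂ) *
      opResolvent (forestAdj S) z (site (forestRoot q)) (forestRoot q)) *
      opResolvent (forestAdj S) z (site (forestRoot p)) (forestRoot p) = -1 := by
  have h := congrArg (fun v : EllTwo (SubstForest S) => v (forestRoot p))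
    (smul_opResolvent_site_root hz p)
  simp only [lp.coeFn_smul, Pi.smul_apply, smul_eq_mul, lp.coeFn_sub, Pi.sub_apply,
    lp.coeFn_sum, Finset.sum_apply, graft_apply_root, Finset.sum_const_zero, site_apply,
    if_true] at h
  rw [zero_sub, Fintype.sum_sigma] at h
  simpa using h

theorem opResolvent_root_sub (hz : z ∉ spectrum ℂ (forestAdj S)) {p q : ι} (i : Fin (S p q))
    (x : SubstTree S q) :
    opResolvent (forestAdj S) z (site ⟨p, SubstTree.sub q i x⟩) (forestRoot p) =
      -(opResolvent (forestAdj S) z (site ⟨q, x⟩) (forestRoot q) *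
        opResolvent (forestAdj S) z (site (forestRoot p)) (forestRoot p)) := by
  rw [opResolvent_site_sub hz, lp.coeFn_sub, Pi.sub_apply, graft_apply_root]
  simp

/-- Below the root exactly one graft contributes to `smul_opResolvent_site_root`; the scalar factor
there is `-1 / Γ_p` by `green_recursion`. -/
theorem opResolvent_sub_root (hz : z ∉ spectrum ℂ (forestAdj S)) {p q : ι} (i : Fin (S p q))
    (x : SubstTree S q) :
    opResolvent (forestAdj S) z (site (forestRoot p)) ⟨p, SubstTree.sub q i x⟩ =
      -(opResolvent (forestAdj S) z (site (forestRoot q)) ⟨q, x⟩ *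
        opResolvent (forestAdj S) z (site (forestRoot p)) (forestRoot p)) := by
  have h := congrArg (fun v : EllTwo (SubstForest S) => v ⟨p, SubstTree.sub q i x⟩)
    (smul_opResolvent_site_root hz p)
  have hrec := green_recursion hz p
  simp only [lp.coeFn_smul, Pi.smul_apply, smul_eq_mul, lp.coeFn_sub, Pi.sub_apply,
    lp.coeFn_sum, Finset.sum_apply, site_apply] at h
  have hs := Fintype.sum_eq_single (f := fun c : (Σ q : ι, Fin (S p q)) =>
    graft c.2 (opResolvent (forestAdj S) z (site (forestRoot c.1))) ⟨p, SubstTree.sub q i x⟩)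
    ⟨q, i⟩ fun c hne => graft_apply_of_ne _ _ fun y h => hne (by cases h; rfl)
  rw [if_neg (fun h => by cases h), sub_zero, hs, graft_apply_sub, Fintype.sum_sigma] at h
  simp only [Finset.sum_const, Finset.card_univ, Fintype.card_fin, nsmul_eq_mul] at h
  rw [← h]
  linear_combination (opResolvent (forestAdj S) z (site (forestRoot p))
    ⟨p, SubstTree.sub q i x⟩) * hrec

theorem opResolvent_sub_sub (hz : z ∉ spectrum ℂ (forestAdj S)) {p q : ι} (i : Fin (S p q))
    (x : SubstTree S q) :
    opResolvent (forestAdj S) z (site ⟨p, SubstTree.sub q i x⟩) ⟨p, SubstTree.sub q i x⟩ =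
      opResolvent (forestAdj S) z (site ⟨q, x⟩) ⟨q, x⟩ +
        opResolvent (forestAdj S) z (site ⟨q, x⟩) (forestRoot q) *
        (opResolvent (forestAdj S) z (site (forestRoot q)) ⟨q, x⟩ *
        opResolvent (forestAdj S) z (site (forestRoot p)) (forestRoot p)) := by
  have h := opResolvent_sub_root hz i x
  rw [opResolvent_site_sub hz, lp.coeFn_sub, Pi.sub_apply, graft_apply_sub, lp.coeFn_smul,
    Pi.smul_apply, h]
  simp

/-- If the diagonal resolvent elements at all roots have real limits along a filter, then so have
the diagonal resolvent elements at all vertices. -/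
theorem exists_real_limit_opResolvent {l : Filter ℂ}
    (hl : ∀ᶠ z in l, z ∉ spectrum ℂ (forestAdj S))
    (h : ∀ p : ι, ∃ r : ℝ, Tendsto (fun z =>
      opResolvent (forestAdj S) z (site (forestRoot p)) (forestRoot p)) l (𝓝 (r : ℂ)))
    {p : ι} (x : SubstTree S p) :
    (∃ r : ℝ, Tendsto (fun z =>
      opResolvent (forestAdj S) z (site ⟨p, x⟩) (forestRoot p)) l (𝓝 (r : ℂ))) ∧
    (∃ r : ℝ, Tendsto (fun z =>
      opResolvent (forestAdj S) z (site (forestRoot p)) ⟨p, x⟩) l (𝓝 (r : ℂ))) ∧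
    ∃ r : ℝ, Tendsto (fun z =>
      opResolvent (forestAdj S) z (site ⟨p, x⟩) ⟨p, x⟩) l (𝓝 (r : ℂ)) := by
  induction x with
  | root p => exact ⟨h p, h p, h p⟩
  | sub q i x ih =>
    rename_i p
    obtain ⟨⟨r₁, h₁⟩, ⟨r₂, h₂⟩, r₃, h₃⟩ := ih
    obtain ⟨r, hr⟩ := h p
    refine ⟨⟨-(r₁ * r), ?_⟩, ⟨-(r₂ * r), ?_⟩, r₃ + r₁ * (r₂ * r), ?_⟩
    · push_cast
      refine (h₁.mul hr).neg.congr' ?_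
      filter_upwards [hl] with z hz using (opResolvent_root_sub hz i x).symm
    · push_cast
      refine (h₂.mul hr).neg.congr' ?_
      filter_upwards [hl] with z hz using (opResolvent_sub_root hz i x).symm
    · push_cast
      refine (h₃.add (h₁.mul (h₂.mul hr))).congr' ?_
      filter_upwards [hl] with z hz using (opResolvent_sub_sub hz i x).symm

end Forest

/-! ### The system of equations for the Green's functions -/

theorem im_of_mul_eq_neg_one {w g : ℂ} (h : w * g = -1) : g.im = ‖g‖ ^ 2 * w.im := by
  have h1 : (starRingEnd ℂ g) * (w * g) = -(starRingEnd ℂ g) := by rw [h]; ring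
  have h2 : (starRingEnd ℂ g) * (w * g) = w * ((‖g‖ ^ 2 : ℝ) : ℂ) := by
    rw [← Complex.normSq_eq_norm_sq, ← Complex.mul_conj]; ring
  have h3 := congrArg Complex.im (h2.symm.trans h1)
  rw [Complex.im_mul_ofReal] at h3
  simp only [Complex.neg_im, Complex.conj_im, neg_neg] at h3
  rw [← h3]; ring

theorem im_pos_of_mul_eq_neg_one {w g : ℂ} (h : w * g = -1) (hw : 0 < w.im) : 0 < g.im := by
  have hg : g ≠ 0 := by rintro rfl; simp at h
  rw [im_of_mul_eq_neg_one h]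
  positivity

/-- For `0 < Im z` the recursive system of a substitution tree has at most one solution in the
upper half-plane. -/
theorem recursion_unique {ι : Type} [Fintype ι] (S : Matrix ι ι ℕ) {z : ℂ} (hz : 0 < z.im)
    {g h : ι → ℂ} (hg : ∀ p, 0 < (g p).im) (hh : ∀ p, 0 < (h p).im)
    (eg : ∀ p, (z + ∑ q, (S p q : ℂ) * g q) * g p = -1)
    (eh : ∀ p, (z + ∑ q, (S p q : ℂ) * h q) * h p = -1) : g = h := by
  by_contra hne
  obtain ⟨p₀, hp₀⟩ := Function.ne_iff.1 hne
  -- This is an increasing function of the hyperbolic distance of `g p` and `h p`. It is invariant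
  -- under `w ↦ -1 / w`, does not grow under positive combinations and strictly shrinks under a
  -- shift by `i Im z`, so a positive maximum over the labels is impossible.
  set γ : ι → ℝ := fun p => ‖g p - h p‖ / √((g p).im * (h p).im) with hγ
  have hs : ∀ p, 0 < √((g p).im * (h p).im) := fun p => Real.sqrt_pos.2 (mul_pos (hg p) (hh p))
  obtain ⟨p, -, hp⟩ := Finset.exists_max_image Finset.univ γ ⟨p₀, Finset.mem_univ _⟩
  have hM : 0 < γ p := lt_of_lt_of_le
    (div_pos (norm_pos_iff.2 (sub_ne_zero.2 hp₀)) (hs p₀)) (hp p₀ (Finset.mem_univ _))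
  set M := γ p with hMdef
  have hle : ∀ q, ‖g q - h q‖ ≤ M * √((g q).im * (h q).im) := fun q =>
    (div_le_iff₀ (hs q)).1 (hp q (Finset.mem_univ _))
  set w := ∑ q, (S p q : ℂ) * g q
  set w' := ∑ q, (S p q : ℂ) * h q
  have hw : w.im = ∑ q, (S p q : ℝ) * (g q).im := by simp [w]
  have hw' : w'.im = ∑ q, (S p q : ℝ) * (h q).im := by simp [w']
  have hw0 : 0 ≤ w.im := hw ▸ Finset.sum_nonneg fun q _ =>
    mul_nonneg (Nat.cast_nonneg _) (hg q).le
  have hw0' : 0 ≤ w'.im := hw' ▸ Finset.sum_nonneg fun q _ =>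
    mul_nonneg (Nat.cast_nonneg _) (hh q).le
  have hdiff : ‖w - w'‖ ≤ M * √(w.im * w'.im) := by
    have h1 : w - w' = ∑ q, (S p q : ℂ) * (g q - h q) := by
      simp only [w, w', ← Finset.sum_sub_distrib, mul_sub]
    -- Cauchy–Schwarz: a sum with nonnegative weights obeys the same bound `M` as its terms.
    have h2 : ∑ q, √((S p q : ℝ) * (g q).im) * √((S p q : ℝ) * (h q).im) ≤
        √(w.im * w'.im) := by
      have := Real.sum_mul_le_sqrt_mul_sqrt Finset.univ
        (fun q => √((S p q : ℝ) * (g q).im)) (fun q => √((S p q : ℝ) * (h q).im))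
      simp only [Real.sq_sqrt (mul_nonneg (Nat.cast_nonneg (S p _)) (hg _).le),
        Real.sq_sqrt (mul_nonneg (Nat.cast_nonneg (S p _)) (hh _).le), ← hw, ← hw'] at this
      rwa [← Real.sqrt_mul hw0] at this
    rw [h1]
    calc ‖∑ q, (S p q : ℂ) * (g q - h q)‖
        ≤ ∑ q, (S p q : ℝ) * ‖g q - h q‖ := by
          refine (norm_sum_le _ _).trans (Finset.sum_le_sum fun q _ => ?_)
          rw [norm_mul, Complex.norm_natCast]
      _ ≤ ∑ q, M * (√((S p q : ℝ) * (g q).im) * √((S p q : ℝ) * (h q).im)) := by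
          refine Finset.sum_le_sum fun q _ => ?_
          rw [Real.sqrt_mul (Nat.cast_nonneg _), Real.sqrt_mul (Nat.cast_nonneg _)]
          have e : √(S p q : ℝ) * √(S p q : ℝ) = S p q := Real.mul_self_sqrt (Nat.cast_nonneg _)
          have := mul_le_mul_of_nonneg_left (hle q) (Nat.cast_nonneg (α := ℝ) (S p q))
          rw [Real.sqrt_mul (hg q).le] at this
          calc _ ≤ _ := this
            _ = (√(S p q : ℝ) * √(S p q : ℝ)) * (M * (√(g q).im * √(h q).im)) := by rw [e]
            _ = _ := by ring
      _ ≤ M * √(w.im * w'.im) := by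
          rw [← Finset.mul_sum]
          gcongr
  have hgp : g p ≠ 0 := fun h0 => by simpa [h0] using hg p
  have hhp : h p ≠ 0 := fun h0 => by simpa [h0] using hh p
  have hsub : g p - h p = g p * h p * (w - w') := by
    linear_combination (-h p) * eg p + (g p) * eh p
  have heq : ‖g p - h p‖ = M * √((g p).im * (h p).im) := by
    rw [hMdef, hγ]; exact (div_mul_cancel₀ _ (hs p).ne').symm
  have him : √((g p).im * (h p).im) =
      ‖g p‖ * ‖h p‖ * √((z.im + w.im) * (z.im + w'.im)) := by
    have e : ‖g p‖ ^ 2 * (z.im + w.im) * (‖h p‖ ^ 2 * (z.im + w'.im)) =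
        (‖g p‖ * ‖h p‖) ^ 2 * ((z.im + w.im) * (z.im + w'.im)) := by ring
    rw [im_of_mul_eq_neg_one (eg p), im_of_mul_eq_neg_one (eh p), Complex.add_im, Complex.add_im,
      e, Real.sqrt_mul (by positivity), Real.sqrt_sq (by positivity)]
  have hlt : √(w.im * w'.im) < √((z.im + w.im) * (z.im + w'.im)) := by
    refine Real.sqrt_lt_sqrt (mul_nonneg hw0 hw0') ?_
    have h1 := mul_pos hz hz
    have h2 := mul_nonneg hz.le hw0
    have h3 := mul_nonneg hz.le hw0'
    linarith
  have hpos : 0 < ‖g p‖ * ‖h p‖ := by positivity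
  have hcon : ‖g p - h p‖ < ‖g p - h p‖ :=
    calc ‖g p - h p‖ = ‖g p‖ * ‖h p‖ * ‖w - w'‖ := by rw [hsub, norm_mul, norm_mul]
      _ ≤ ‖g p‖ * ‖h p‖ * (M * √(w.im * w'.im)) := by gcongr
      _ < ‖g p‖ * ‖h p‖ * (M * √((z.im + w.im) * (z.im + w'.im))) := by gcongr
      _ = ‖g p - h p‖ := by rw [heq, him]; ring
  exact lt_irrefl _ hcon

/-! ### Real cubics -/

/-- The discriminant of a real cubic, in terms of a nonreal root. -/
theorem discr_eq_of_root {a b c d u v : ℝ} (hv : v ≠ 0)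
    (h : (a : ℂ) * (u + v * Complex.I) ^ 3 + b * (u + v * Complex.I) ^ 2 +
      c * (u + v * Complex.I) + d = 0) :
    c = -(a * (3 * u ^ 2 - v ^ 2)) - 2 * b * u ∧
    18 * a * b * c * d - 4 * b ^ 3 * d + b ^ 2 * c ^ 2 - 4 * a * c ^ 3 - 27 * a ^ 2 * d ^ 2 =
      -4 * v ^ 2 * ((b + 3 * a * u) ^ 2 + a ^ 2 * v ^ 2) ^ 2 := by
  have hre := congrArg Complex.re h
  have him := congrArg Complex.im h
  simp [pow_succ, Complex.add_re, Complex.mul_re, Complex.mul_im] at hre him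
  have hc : c = -(a * (3 * u ^ 2 - v ^ 2)) - 2 * b * u := by
    apply mul_left_cancel₀ hv
    linear_combination him
  have hd : d = -(a * (u ^ 3 - 3 * u * v ^ 2) + b * (u ^ 2 - v ^ 2) + c * u) := by
    linear_combination hre
  refine ⟨hc, ?_⟩
  rw [hd, hc]
  ring

/-- The leading coefficient may vanish, as it does for `greenCubic` at zeros of `S_{L-1}`; then `b ≠
0` keeps the second factor in `discr_eq_of_root` positive. -/
theorem discr_neg_of_root {a b c d : ℝ} {g : ℂ} (hb : b ≠ 0) (hg : 0 < g.im)
    (h : (a : ℂ) * g ^ 3 + b * g ^ 2 + c * g + d = 0) :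
    18 * a * b * c * d - 4 * b ^ 3 * d + b ^ 2 * c ^ 2 - 4 * a * c ^ 3 - 27 * a ^ 2 * d ^ 2 < 0 := by
  rw [← Complex.re_add_im g] at h
  rw [(discr_eq_of_root hg.ne' h).2]
  have : 0 < (b + 3 * a * g.re) ^ 2 + a ^ 2 * g.im ^ 2 := by
    by_cases ha : a = 0
    · rw [ha]
      have := pow_pos (abs_pos.2 hb) 2
      rw [sq_abs] at this
      linarith
    · positivity
  have := mul_pos (pow_pos hg 2) (pow_pos this 2)
  linarith

/-- A double nonreal root would come with a double conjugate root, too many for a nonzero real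
polynomial of degree at most three. This is the nondegeneracy needed by the implicit function
theorem. -/
theorem deriv_ne_zero_of_root {a b c d : ℝ} {g : ℂ} (hb : b ≠ 0) (hg : 0 < g.im)
    (h : (a : ℂ) * g ^ 3 + b * g ^ 2 + c * g + d = 0) :
    3 * (a : ℂ) * g ^ 2 + 2 * b * g + c ≠ 0 := by
  intro h'
  rw [← Complex.re_add_im g] at h h'
  obtain ⟨hc, -⟩ := discr_eq_of_root hg.ne' h
  have hre := congrArg Complex.re h'
  have him := congrArg Complex.im h'
  simp [pow_succ, Complex.add_re, Complex.mul_re, Complex.mul_im] at hre him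
  have ha : a = 0 := by
    have : g.im ^ 2 * a = 0 := by linear_combination (-1 / 2) * hre + (1 / 2) * hc
    simpa [hg.ne'] using this
  subst ha
  have : g.im * b = 0 := by linear_combination (1 / 2) * him
  simp [hg.ne', hb] at this

theorem exists_root_quadratic {a b c : ℝ} (h : b ^ 2 - 4 * a * c < 0) :
    ∃ g : ℂ, 0 < g.im ∧ (a : ℂ) * g ^ 2 + b * g + c = 0 := by
  have ha : a ≠ 0 := by rintro rfl; nlinarith [sq_nonneg b]
  have hs : 0 < √(4 * a * c - b ^ 2) := Real.sqrt_pos.2 (by linarith)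
  have hsq : (√(4 * a * c - b ^ 2) : ℂ) ^ 2 = 4 * a * c - b ^ 2 := by
    have := Real.sq_sqrt (show 0 ≤ 4 * a * c - b ^ 2 by linarith)
    exact_mod_cast this
  have hI := Complex.I_sq
  set t := √(4 * a * c - b ^ 2)
  have haC : (a : ℂ) ≠ 0 := by exact_mod_cast ha
  refine ⟨((-b / (2 * a) : ℝ) : ℂ) + ((t / (2 * |a|) : ℝ) : ℂ) * Complex.I, ?_, ?_⟩
  · simp only [Complex.add_im, Complex.ofReal_im, Complex.mul_im, Complex.ofReal_re, Complex.I_im,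
      Complex.I_re]
    have : 0 < t / (2 * |a|) := by positivity
    linarith
  · have habs : ((|a| : ℝ) : ℂ) ^ 2 = a ^ 2 := by exact_mod_cast sq_abs a
    have habs0 : ((|a| : ℝ) : ℂ) ≠ 0 := by exact_mod_cast abs_ne_zero.2 ha
    have e : (a : ℂ) * (((-b / (2 * a) : ℝ) : ℂ) + ((t / (2 * |a|) : ℝ) : ℂ) * Complex.I) ^ 2 +
        b * (((-b / (2 * a) : ℝ) : ℂ) + ((t / (2 * |a|) : ℝ) : ℂ) * Complex.I) + c =
        -b ^ 2 / (4 * a) + a * (t : ℂ) ^ 2 / (4 * ((|a| : ℝ) : ℂ) ^ 2) * Complex.I ^ 2 + c := by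
      push_cast
      field_simp
      ring
    rw [e, hI, hsq, habs]
    field_simp
    ring

theorem exists_root_of_discr_neg {a b c d : ℝ}
    (h : 18 * a * b * c * d - 4 * b ^ 3 * d + b ^ 2 * c ^ 2 - 4 * a * c ^ 3 -
      27 * a ^ 2 * d ^ 2 < 0) :
    ∃ g : ℂ, 0 < g.im ∧ (a : ℂ) * g ^ 3 + b * g ^ 2 + c * g + d = 0 := by
  by_cases ha : a = 0
  · subst ha
    have h1 : b ^ 2 * (c ^ 2 - 4 * b * d) < 0 := by linarith
    have h2 : c ^ 2 - 4 * b * d < 0 := by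
      by_contra! h3
      exact absurd h1 (not_lt.2 (by positivity))
    simpa using exists_root_quadratic h2
  · obtain ⟨g, hg⟩ := IsAlgClosed.exists_root
      (Polynomial.C (a : ℂ) * Polynomial.X ^ 3 + Polynomial.C (b : ℂ) * Polynomial.X ^ 2 +
        Polynomial.C (c : ℂ) * Polynomial.X + Polynomial.C (d : ℂ))
      (by rw [Polynomial.degree_cubic (by exact_mod_cast ha)]; decide)
    simp only [Polynomial.IsRoot, Polynomial.eval_add, Polynomial.eval_mul, Polynomial.eval_C,
      Polynomial.eval_pow, Polynomial.eval_X] at hg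
    rcases lt_trichotomy g.im 0 with hi | hi | hi
    · refine ⟨starRingEnd ℂ g, by simpa using hi, ?_⟩
      have := congrArg (starRingEnd ℂ) hg
      simpa using this
    · obtain ⟨r, rfl⟩ : ∃ r : ℝ, g = r := ⟨g.re, Complex.ext rfl (by simp [hi])⟩
      have hr : a * r ^ 3 + b * r ^ 2 + c * r + d = 0 := by exact_mod_cast hg
      have hd : d = -(a * r ^ 3 + b * r ^ 2 + c * r) := by linarith
      -- Splitting off the real root `r`, the discriminant is the squared derivative at `r` times
      -- the discriminant of the quadratic cofactor.
      have hfac : 18 * a * b * c * d - 4 * b ^ 3 * d + b ^ 2 * c ^ 2 - 4 * a * c ^ 3 -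
          27 * a ^ 2 * d ^ 2 = (3 * a * r ^ 2 + 2 * b * r + c) ^ 2 *
          ((a * r + b) ^ 2 - 4 * a * (a * r ^ 2 + b * r + c)) := by
        rw [hd]; ring
      rw [hfac] at h
      have h2 : (a * r + b) ^ 2 - 4 * a * (a * r ^ 2 + b * r + c) < 0 := by
        by_contra! h3
        exact absurd h (not_lt.2 (by positivity))
      obtain ⟨g, hg, hq⟩ := exists_root_quadratic h2
      refine ⟨g, hg, ?_⟩
      push_cast at hq
      rw [hd]
      push_cast
      linear_combination (g - r) * hq
    · exact ⟨g, hi, hg⟩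

/-! ### Finite unions of open intervals -/

/-- Each point of `A` has a nearest frontier point on either side, by boundedness and finiteness,
and the interval between them lies in `A` because a connected set meeting `A` and its complement
meets the frontier. -/
theorem isNonemptyFiniteUnionOfIoo_of_finite_frontier {A : Set ℝ} (hA : IsOpen A)
    (hne : A.Nonempty) (hb : Bornology.IsBounded A) (hf : (frontier A).Finite) :
    IsNonemptyFiniteUnionOfIoo A := by
  classical
  have hdisj : ∀ x ∈ A, x ∉ frontier A := fun x hx hx' => by
    have := hA.inter_frontier_eq
    exact (this ▸ (⟨hx, hx'⟩ : x ∈ A ∩ frontier A) : x ∈ (∅ : Set ℝ))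
  have hconn : ∀ s : Set ℝ, IsPreconnected s → (s ∩ A).Nonempty → (s ∩ Aᶜ).Nonempty →
      (s ∩ frontier A).Nonempty := by
    intro s hs h1 h2
    by_contra h3
    rw [not_nonempty_iff_eq_empty] at h3
    obtain ⟨x, hx, hxA, hxc⟩ := hs A (closure A)ᶜ hA isClosed_closure.isOpen_compl
      (fun y hy => by
        by_contra hy'
        rw [mem_union, not_or, mem_compl_iff, not_not] at hy'
        have : y ∈ s ∩ frontier A := ⟨hy, hy'.2, by rw [hA.interior_eq]; exact hy'.1⟩
        rw [h3] at this
        exact this) h1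
      (by
        obtain ⟨y, hy, hyc⟩ := h2
        refine ⟨y, hy, fun hyc' => ?_⟩
        have : y ∈ s ∩ frontier A := ⟨hy, hyc', by rw [hA.interior_eq]; exact hyc⟩
        rw [h3] at this
        exact this)
    exact hxc (subset_closure hxA)
  obtain ⟨R, hR⟩ := hb.subset_ball 0
  set F := hf.toFinset with hF
  have hmemF : ∀ y, y ∈ F ↔ y ∈ frontier A := fun y => hf.mem_toFinset
  have key : ∀ x ∈ A, ∃ q ∈ (F ×ˢ F).filter (fun q => q.1 < q.2 ∧ Ioo q.1 q.2 ⊆ A),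
      x ∈ Ioo q.1 q.2 := by
    intro x hx
    have hxR := hR hx
    rw [Metric.mem_ball, dist_zero_right, Real.norm_eq_abs, abs_lt] at hxR
    have hlow : (F.filter (· < x)).Nonempty := by
      obtain ⟨y, hy, hy'⟩ := hconn (Icc (-R) x) isPreconnected_Icc ⟨x, ⟨hxR.1.le, le_rfl⟩, hx⟩
        ⟨-R, ⟨le_rfl, hxR.1.le⟩, fun h => by
          have := hR h
          rw [Metric.mem_ball, dist_zero_right, Real.norm_eq_abs, abs_neg] at this
          exact absurd (le_abs_self R) (not_le.2 this)⟩
      refine ⟨y, Finset.mem_filter.2 ⟨(hmemF y).2 hy', hy.2.lt_of_ne ?_⟩⟩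
      rintro rfl
      exact hdisj y hx hy'
    have hupp : (F.filter (x < ·)).Nonempty := by
      obtain ⟨y, hy, hy'⟩ := hconn (Icc x R) isPreconnected_Icc ⟨x, ⟨le_rfl, hxR.2.le⟩, hx⟩
        ⟨R, ⟨hxR.2.le, le_rfl⟩, fun h => by
          have := hR h
          rw [Metric.mem_ball, dist_zero_right, Real.norm_eq_abs] at this
          exact absurd (le_abs_self R) (not_le.2 this)⟩
      refine ⟨y, Finset.mem_filter.2 ⟨(hmemF y).2 hy', hy.1.lt_of_ne ?_⟩⟩
      rintro rfl
      exact hdisj x hx hy'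
    obtain ⟨a, ha, hamax⟩ := Finset.exists_max_image _ id hlow
    obtain ⟨b, hb, hbmin⟩ := Finset.exists_min_image _ id hupp
    rw [Finset.mem_filter] at ha hb
    have hsub : Ioo a b ⊆ A := by
      intro y hy
      by_contra hyA
      obtain ⟨w, hw, hwF⟩ := hconn (Ioo a b) isPreconnected_Ioo ⟨x, ⟨ha.2, hb.2⟩, hx⟩ ⟨y, hy, hyA⟩
      rcases lt_trichotomy w x with h | h | h
      · exact absurd (hamax w (Finset.mem_filter.2 ⟨(hmemF w).2 hwF, h⟩)) (not_le.2 hw.1)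
      · exact hdisj x hx (h ▸ hwF)
      · exact absurd (hbmin w (Finset.mem_filter.2 ⟨(hmemF w).2 hwF, h⟩)) (not_le.2 hw.2)
    exact ⟨(a, b), Finset.mem_filter.2 ⟨Finset.mk_mem_product ha.1 hb.1, ha.2.trans hb.2, hsub⟩,
      ha.2, hb.2⟩
  refine ⟨(F ×ˢ F).filter (fun q => q.1 < q.2 ∧ Ioo q.1 q.2 ⊆ A), ?_, ?_, ?_⟩
  · obtain ⟨x, hx⟩ := hne
    obtain ⟨q, hq, -⟩ := key x hx
    exact ⟨q, hq⟩
  · exact fun q hq => (Finset.mem_filter.1 hq).2.1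
  · ext x
    simp only [mem_iUnion, exists_prop]
    exact ⟨key x, fun ⟨q, hq, hx⟩ => (Finset.mem_filter.1 hq).2.2 hx⟩

theorem closure_diff_finite {A F : Set ℝ} (hA : IsOpen A) (hF : F.Finite) :
    closure (A \ F) = closure A := by
  have hd : Dense Fᶜ := hF.countable.dense_compl ℝ
  rw [sdiff_eq]
  exact Subset.antisymm (closure_mono inter_subset_left)
    (closure_minimal (hd.open_subset_closure_inter hA) isClosed_closure)

/-! ### The cubic equation for the Green's function -/

namespace FibTree

open Polynomial (Chebyshev.S)

/-- The denominator `S_j(z) + S_{j-1}(z) g` of the `j`-th iterate of `g ↦ -1 / (z + g)`. -/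
noncomputable def iterDen (j : ℤ) (z g : ℂ) : ℂ :=
  (Chebyshev.S ℂ j).eval z + (Chebyshev.S ℂ (j - 1)).eval z * g

theorem iterDen_add_one (j : ℤ) (z g : ℂ) :
    iterDen (j + 1) z g = z * iterDen j z g - iterDen (j - 1) z g := by
  have h1 := congrArg (Polynomial.eval z) (Polynomial.Chebyshev.S_add_one ℂ j)
  have h2 := congrArg (Polynomial.eval z) (Polynomial.Chebyshev.S_add_one ℂ (j - 1))
  simp only [Polynomial.eval_sub, Polynomial.eval_mul, Polynomial.eval_X, sub_add_cancel] at h1 h2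
  simp only [iterDen, add_sub_cancel_right]
  linear_combination h1 + g * h2

theorem iterDen_zero (z g : ℂ) : iterDen 0 z g = 1 := by simp [iterDen]

theorem iterDen_neg_one (z g : ℂ) : iterDen (-1) z g = -g := by
  simp [iterDen, show (-1 - 1 : ℤ) = -2 by norm_num]

/-- The cubic polynomial in `g` satisfied by `g = Γ^{(0)}_z`. -/
noncomputable def greenCubic (K L : ℕ) (z g : ℂ) : ℂ :=
  (K * (Chebyshev.S ℂ (L - 1)).eval z) * g ^ 3 + ((K + 1) * (Chebyshev.S ℂ L).eval z) * g ^ 2 +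
    (z * (Chebyshev.S ℂ L).eval z) * g + (Chebyshev.S ℂ L).eval z

theorem greenCubic_eq (K L : ℕ) (z g : ℂ) :
    greenCubic K L z g = (iterDen (L + 1) z g + K * g * iterDen L z g) * g + iterDen L z g := by
  have h1 := congrArg (Polynomial.eval z) (Polynomial.Chebyshev.S_add_one ℂ L)
  simp only [Polynomial.eval_sub, Polynomial.eval_mul, Polynomial.eval_X] at h1
  simp only [greenCubic, iterDen, add_sub_cancel_right]
  linear_combination (-g) * h1

theorem continuous_greenCubic (K L : ℕ) :
    Continuous fun w : ℂ × ℂ => greenCubic K L w.1 w.2 := by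
  unfold greenCubic; fun_prop

variable {K L : ℕ}

/-- The label `-j` modulo `L + 1`. -/
def labelBack (L j : ℕ) : Fin (L + 1) := ⟨(L + 1 - j) % (L + 1), Nat.mod_lt _ (by omega)⟩

theorem labelBack_zero : labelBack L 0 = 0 := by simp [labelBack]

theorem val_labelBack {j : ℕ} (h0 : 1 ≤ j) : (labelBack L j).val = L + 1 - j :=
  Nat.mod_eq_of_lt (by omega)

theorem exists_labelBack (p : Fin (L + 1)) : ∃ j ≤ L, labelBack L j = p := by
  by_cases hp : p.val = 0
  · exact ⟨0, by omega, by rw [labelBack_zero]; exact Fin.ext hp.symm⟩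
  · exact ⟨L + 1 - p.val, by omega, Fin.ext (by rw [val_labelBack (by omega)]; omega)⟩

theorem sum_substMatrix_labelBack_succ {j : ℕ} (hj : j < L) (g : Fin (L + 1) → ℂ) :
    ∑ q, (substMatrix K L (labelBack L (j + 1)) q : ℂ) * g q = g (labelBack L j) := by
  rw [Finset.sum_eq_single (labelBack L j)]
  · have h1 := val_labelBack (L := L) (j := j + 1) (by omega)
    have : substMatrix K L (labelBack L (j + 1)) (labelBack L j) = 1 := by
      rcases Nat.eq_zero_or_pos j with rfl | h0
      · have h3 : (labelBack L 0).val = 0 := by rw [labelBack_zero]; rfl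
        rw [substMatrix, Matrix.of_apply, if_neg (by omega), if_neg (by omega),
          if_pos ⟨by omega, h3⟩]
      · have h2 := val_labelBack (L := L) h0
        simp only [substMatrix, Matrix.of_apply, h1, h2]
        split_ifs <;> omega
    rw [this]; simp
  · intro q _ hq
    have h1 := val_labelBack (L := L) (j := j + 1) (by omega)
    have : substMatrix K L (labelBack L (j + 1)) q = 0 := by
      simp only [substMatrix, Matrix.of_apply, h1]
      rw [if_neg (by omega), if_neg, if_neg]
      · rintro ⟨h2, h3⟩
        have : j = 0 := by omega
        subst this
        exact hq (Fin.ext (by rw [labelBack_zero]; exact h3))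
      · intro h2
        by_cases h0 : j = 0
        · have := q.2; omega
        · exact hq (Fin.ext (by rw [val_labelBack (by omega)]; omega))
    rw [this]; simp
  · simp

theorem sum_substMatrix_zero (hL : 1 ≤ L) (g : Fin (L + 1) → ℂ) :
    ∑ q, (substMatrix K L 0 q : ℂ) * g q = g (labelBack L L) + K * g 0 := by
  have h1 := val_labelBack (L := L) (j := L) hL
  have : ∀ q, (substMatrix K L 0 q : ℂ) * g q =
      (if q = labelBack L L then g (labelBack L L) else 0) + if q = 0 then K * g 0 else 0 := by
    intro q
    by_cases hq : q = 0
    · have : ¬ (0 : Fin (L + 1)) = labelBack L L := fun h => by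
        have := congrArg Fin.val h
        rw [h1] at this
        simp at this
      subst hq
      simp [substMatrix, this]
    · by_cases hq2 : q = labelBack L L
      · subst hq2
        simp [substMatrix, hq, h1]
      · have h3 : q.val ≠ 0 := fun h => hq (Fin.ext h)
        have h4 : q.val ≠ 1 := fun h => hq2 (Fin.ext (by omega))
        simp [substMatrix, hq, hq2, h4]
  simp_rw [this, Finset.sum_add_distrib, Finset.sum_ite_eq']
  simp

/-- A solution of the recursion for the Green's functions, expressed through `g 0`. -/
theorem mul_iterDen {z : ℂ} {g : Fin (L + 1) → ℂ}
    (h : ∀ p, (z + ∑ q, (substMatrix K L p q : ℂ) * g q) * g p = -1) (j : ℕ) (hj : j ≤ L) :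
    iterDen j z (g 0) ≠ 0 ∧
      g (labelBack L j) * iterDen j z (g 0) = -iterDen (j - 1) z (g 0) := by
  induction j with
  | zero =>
    rw [labelBack_zero]
    simp [iterDen_zero, iterDen_neg_one]
  | succ j ih =>
    obtain ⟨h1, h2⟩ := ih (by omega)
    have h3 := h (labelBack L (j + 1))
    rw [sum_substMatrix_labelBack_succ (by omega)] at h3
    have h4 := iterDen_add_one j z (g 0)
    push_cast
    rw [add_sub_cancel_right]
    have h5 : g (labelBack L (j + 1)) * iterDen (j + 1) z (g 0) = -iterDen j z (g 0) := by
      rw [h4]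
      linear_combination iterDen j z (g 0) * h3 - g (labelBack L (j + 1)) * h2
    refine ⟨fun h0 => h1 ?_, h5⟩
    rw [h0, mul_zero] at h5
    exact neg_eq_zero.1 h5.symm

theorem greenCubic_eq_zero_of_recursion (hL : 1 ≤ L) {z : ℂ} {g : Fin (L + 1) → ℂ}
    (h : ∀ p, (z + ∑ q, (substMatrix K L p q : ℂ) * g q) * g p = -1) :
    greenCubic K L z (g 0) = 0 := by
  obtain ⟨-, h2⟩ := mul_iterDen h L le_rfl
  have h3 := h 0
  rw [sum_substMatrix_zero hL] at h3
  rw [greenCubic_eq, iterDen_add_one]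
  linear_combination iterDen L z (g 0) * h3 - g 0 * h2

/-- Iterating `g ↦ -1 / (z + g)` stays in the upper half-plane, so no denominator vanishes, and the
cubic is what closes the cycle of labels at `0`. -/
theorem exists_recursion_of_greenCubic (hL : 1 ≤ L) {z g : ℂ} (hz : 0 < z.im) (hg : 0 < g.im)
    (h : greenCubic K L z g = 0) :
    ∃ f : Fin (L + 1) → ℂ, f 0 = g ∧ (∀ p, 0 < (f p).im) ∧
      ∀ p, (z + ∑ q, (substMatrix K L p q : ℂ) * f q) * f p = -1 := by
  set G : ℕ → ℂ := fun j => -iterDen (j - 1) z g / iterDen j z g with hG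
  have hG0 : G 0 = g := by simp [hG, iterDen_neg_one, iterDen_zero]
  have key : ∀ j : ℕ, iterDen j z g ≠ 0 ∧ 0 < (G j).im := by
    intro j
    induction j with
    | zero => exact ⟨by simp [iterDen_zero], by rw [hG0]; exact hg⟩
    | succ j ih =>
      have h1 : iterDen (j + 1) z g = (z + G j) * iterDen j z g := by
        rw [iterDen_add_one, add_mul, hG, div_mul_cancel₀ _ ih.1]; ring
      have h2 : 0 < (z + G j).im := by rw [Complex.add_im]; linarith [ih.2]
      have h3 : z + G j ≠ 0 := fun h0 => by simp [h0] at h2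
      have h4 : iterDen (j + 1) z g ≠ 0 := by rw [h1]; exact mul_ne_zero h3 ih.1
      refine ⟨by push_cast; exact h4, im_pos_of_mul_eq_neg_one (w := z + G j) ?_ h2⟩
      simp only [hG]
      push_cast
      rw [add_sub_cancel_right, ← mul_div_assoc, div_eq_iff h4, h1]
      simp only [hG]
      ring
  have hrec : ∀ j : ℕ, (z + G j) * G (j + 1) = -1 := by
    intro j
    have h1 : iterDen (j + 1) z g = (z + G j) * iterDen j z g := by
      rw [iterDen_add_one, add_mul, hG, div_mul_cancel₀ _ (key j).1]; ring
    have h4 : iterDen (j + 1) z g ≠ 0 := by exact_mod_cast (key (j + 1)).1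
    have : G (j + 1) = -iterDen j z g / iterDen (j + 1) z g := by
      simp only [hG]; push_cast; rw [add_sub_cancel_right]
    rw [this, ← mul_div_assoc, div_eq_iff h4, h1]
    ring
  set f : Fin (L + 1) → ℂ := fun p => G (labelBack L p.val).val
  have hf : ∀ j ≤ L, f (labelBack L j) = G j := by
    intro j hj
    have : (labelBack L (labelBack L j).val).val = j := by
      rcases Nat.eq_zero_or_pos j with rfl | h0
      · simp [labelBack_zero]
      · rw [val_labelBack h0, val_labelBack (by omega)]; omega
    simp only [f, this]
  have hf0 : f 0 = g := by rw [← labelBack_zero, hf 0 (by omega), hG0]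
  refine ⟨f, hf0, fun p => (key _).2, fun p => ?_⟩
  obtain ⟨j, hj, rfl⟩ := exists_labelBack p
  cases j with
  | zero =>
    rw [labelBack_zero, sum_substMatrix_zero hL, hf L le_rfl, hf0]
    rw [greenCubic_eq, iterDen_add_one] at h
    have h1 : G L * iterDen L z g = -iterDen (L - 1) z g := div_mul_cancel₀ _ (key L).1
    apply mul_left_cancel₀ (key L).1
    linear_combination h + g * h1
  | succ j =>
    rw [sum_substMatrix_labelBack_succ (by omega), hf _ hj, hf j (by omega)]
    exact hrec j

/-! ### The Green's functions -/

theorem ket_eq_site (x : Forest K L) : ket x = site x := by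
  classical
  ext y
  rw [site_apply, ket, lp.coeFn_single, Pi.single_apply]
  congr

theorem green_eq_inner (p : Fin (L + 1)) (z : ℂ) :
    green K L p z = inner ℂ (site (forestRoot p))
      (opResolvent (adj K L) z (site (forestRoot p))) := by
  rw [green, ket_eq_site]
  rfl

theorem green_eq (p : Fin (L + 1)) (z : ℂ) :
    green K L p z = opResolvent (adj K L) z (site (forestRoot p)) (forestRoot p) := by
  rw [green_eq_inner, inner_site]

theorem notMem_spectrum_adj {z : ℂ} (hz : 0 < z.im) : z ∉ spectrum ℂ (adj K L) :=
  notMem_spectrum_of_im_pos (adj_isSelfAdjoint K L) hz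

theorem green_system {z : ℂ} (hz : 0 < z.im) (p : Fin (L + 1)) :
    (z + ∑ q, (substMatrix K L p q : ℂ) * green K L q z) * green K L p z = -1 := by
  simp_rw [green_eq]
  exact green_recursion (notMem_spectrum_adj hz) p

theorem green_im_pos {z : ℂ} (hz : 0 < z.im) (p : Fin (L + 1)) : 0 < (green K L p z).im := by
  have h := sub_opResolvent_apply (notMem_spectrum_adj (K := K) (L := L) hz)
    (site (forestRoot p))
  rw [green_eq_inner, im_inner_opResolvent (adj_isSelfAdjoint K L) hz]
  have : opResolvent (adj K L) z (site (forestRoot p)) ≠ 0 := by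
    intro h0
    rw [h0, map_zero, smul_zero, sub_zero] at h
    have := congrArg (fun v : EllTwo (Forest K L) => v (forestRoot p)) h
    simp [site_apply] at this
  positivity

theorem greenCubic_green (hL : 1 ≤ L) {z : ℂ} (hz : 0 < z.im) :
    greenCubic K L z (green K L 0 z) = 0 :=
  greenCubic_eq_zero_of_recursion hL (g := fun p => green K L p z) (green_system hz)

theorem green_eq_of_greenCubic (hL : 1 ≤ L) {z g : ℂ} (hz : 0 < z.im) (hg : 0 < g.im)
    (h : greenCubic K L z g = 0) : green K L 0 z = g := by
  obtain ⟨f, hf0, hf1, hf2⟩ := exists_recursion_of_greenCubic hL hz hg h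
  rw [← hf0]
  exact congrFun (recursion_unique (substMatrix K L) hz (fun p => green_im_pos hz p) hf1
    (green_system hz) hf2) 0

/-- The filter of points `E + iη` with `η ↓ 0`. -/
noncomputable def nhdsAbove (E : ℝ) : Filter ℂ :=
  map (fun η : ℝ => (E : ℂ) + η * Complex.I) (𝓝[>] 0)

theorem tendsto_nhdsAbove_iff {E : ℝ} {f : ℂ → ℂ} {l : Filter ℂ} :
    Tendsto (fun η : ℝ => f ((E : ℂ) + η * Complex.I)) (𝓝[>] (0 : ℝ)) l ↔
      Tendsto f (nhdsAbove E) l := by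
  rw [nhdsAbove, tendsto_map'_iff]; rfl

instance (E : ℝ) : (nhdsAbove E).NeBot := by unfold nhdsAbove; infer_instance

theorem nhdsAbove_le (E : ℝ) : nhdsAbove E ≤ 𝓝 (E : ℂ) := by
  have h : Tendsto (fun η : ℝ => (E : ℂ) + η * Complex.I) (𝓝 0)
      (𝓝 ((E : ℂ) + (0 : ℝ) * Complex.I)) := Continuous.tendsto (by fun_prop) 0
  rw [Complex.ofReal_zero, zero_mul, add_zero] at h
  exact h.mono_left nhdsWithin_le_nhds

theorem eventually_nhdsAbove_im_pos (E : ℝ) : ∀ᶠ z in nhdsAbove E, 0 < z.im := by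
  rw [nhdsAbove, eventually_map]
  filter_upwards [self_mem_nhdsWithin] with η hη
  rw [add_mul_I_im]; exact hη

theorem mem_energySet {p : Fin (L + 1)} {E : ℝ} :
    E ∈ energySet K L p ↔
      ∃ g : ℂ, Tendsto (green K L p) (nhdsAbove E) (𝓝 g) ∧ 0 < g.im := by
  simp only [energySet, mem_ofPred_eq, tendsto_nhdsAbove_iff]

theorem greenBdry_eq {p : Fin (L + 1)} {E : ℝ} {g : ℂ}
    (h : Tendsto (green K L p) (nhdsAbove E) (𝓝 g)) : greenBdry K L p E = g :=
  (tendsto_nhdsAbove_iff.2 h).limUnder_eq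

theorem green_labelBack_succ {z : ℂ} (hz : 0 < z.im) {j : ℕ} (hj : j < L) :
    (z + green K L (labelBack L j) z) * green K L (labelBack L (j + 1)) z = -1 := by
  have h := green_system (K := K) hz (labelBack L (j + 1))
  rwa [sum_substMatrix_labelBack_succ hj fun q => green K L q z] at h

theorem tendsto_green_succ {E : ℝ} {g : ℂ} {j : ℕ} (hj : j < L) (hg : (E : ℂ) + g ≠ 0)
    (h : Tendsto (green K L (labelBack L j)) (nhdsAbove E) (𝓝 g)) :
    Tendsto (green K L (labelBack L (j + 1))) (nhdsAbove E) (𝓝 (-((E : ℂ) + g)⁻¹)) := by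
  refine (((tendsto_id.mono_left (nhdsAbove_le E)).add h).inv₀ hg).neg.congr' ?_
  filter_upwards [eventually_nhdsAbove_im_pos E] with z hz
  have h1 := green_labelBack_succ (K := K) hz hj
  have h2 : z + green K L (labelBack L j) z ≠ 0 := fun h0 => by simp [h0] at h1
  have := eq_div_of_mul_eq h2 ((mul_comm _ _).trans h1)
  rw [this, neg_div, one_div]; rfl

theorem add_ofReal_im_pos (E : ℝ) {g : ℂ} (hg : 0 < g.im) : 0 < ((E : ℂ) + g).im := by
  simpa using hg

theorem ne_zero_of_im_pos {g : ℂ} (hg : 0 < g.im) : g ≠ 0 := fun h => by simp [h] at hg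

/-- Both `g ↦ -1 / (E + g)` and its inverse preserve the upper half-plane, so a nonreal boundary
value passes between neighbouring labels in both directions. -/
theorem energySet_labelBack {j : ℕ} (hj : j ≤ L) :
    energySet K L (labelBack L j) = energySet K L 0 := by
  induction j with
  | zero => rw [labelBack_zero]
  | succ j ih =>
    rw [← ih (by omega)]
    ext E
    rw [mem_energySet, mem_energySet]
    constructor
    · rintro ⟨g, hg, hi⟩
      have hg0 := ne_zero_of_im_pos hi
      have hw : (-g⁻¹) * g = -1 := by rw [neg_mul, inv_mul_cancel₀ hg0]
      have hw' : g * (-g⁻¹) = -1 := by rw [mul_comm, hw]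
      refine ⟨-g⁻¹ - E, ?_, ?_⟩
      · refine ((hg.inv₀ hg0).neg.sub (tendsto_id.mono_left (nhdsAbove_le E))).congr' ?_
        filter_upwards [eventually_nhdsAbove_im_pos E] with z hz
        have h1 := green_labelBack_succ (K := K) hz (show j < L by omega)
        have h2 := ne_zero_of_im_pos (green_im_pos (K := K) hz (labelBack L (j + 1)))
        have := eq_div_of_mul_eq h2 h1
        rw [neg_div, one_div] at this
        rw [← this]
        simp
      · have := im_pos_of_mul_eq_neg_one hw' hi
        simpa using this
    · rintro ⟨g, hg, hi⟩
      have h1 := add_ofReal_im_pos E hi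
      have h2 := ne_zero_of_im_pos h1
      refine ⟨_, tendsto_green_succ (by omega) h2 hg, im_pos_of_mul_eq_neg_one ?_ h1⟩
      rw [mul_neg, mul_inv_cancel₀ h2]

theorem energySet_eq (p : Fin (L + 1)) : energySet K L p = energySet K L 0 := by
  obtain ⟨j, hj, rfl⟩ := exists_labelBack p
  exact energySet_labelBack hj

/-! ### The energy set -/

/-- The factor of the discriminant of `greenCubic` that determines its sign. -/
noncomputable def energyDiscr (K L : ℕ) : Polynomial ℝ :=
  Polynomial.C (((K : ℝ) + 1) ^ 2) * Chebyshev.S ℝ L ^ 2 *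
      (Polynomial.X ^ 2 - Polynomial.C (4 * ((K : ℝ) + 1))) +
    Polynomial.C (K : ℝ) * Chebyshev.S ℝ L * Chebyshev.S ℝ (L - 1) *
      (Polynomial.C (18 * ((K : ℝ) + 1)) * Polynomial.X - Polynomial.C 4 * Polynomial.X ^ 3) -
    Polynomial.C (27 * (K : ℝ) ^ 2) * Chebyshev.S ℝ (L - 1) ^ 2

theorem energyDiscr_eval (K L : ℕ) (E : ℝ) : (energyDiscr K L).eval E =
    ((K : ℝ) + 1) ^ 2 * (Chebyshev.S ℝ L).eval E ^ 2 * (E ^ 2 - 4 * ((K : ℝ) + 1)) +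
      K * (Chebyshev.S ℝ L).eval E * (Chebyshev.S ℝ (L - 1)).eval E *
        (18 * ((K : ℝ) + 1) * E - 4 * E ^ 3) -
      27 * (K : ℝ) ^ 2 * (Chebyshev.S ℝ (L - 1)).eval E ^ 2 := by
  simp [energyDiscr]

theorem eval_S_ofReal (n : ℤ) (E : ℝ) :
    (Chebyshev.S ℂ n).eval (E : ℂ) = (((Chebyshev.S ℝ n).eval E : ℝ) : ℂ) :=
  (Polynomial.Chebyshev.algebraMap_eval_S (R := ℝ) (R' := ℂ) E n).symm

theorem eval_S_sq_add (L : ℕ) (E : ℝ) :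
    (Chebyshev.S ℝ (L - 1)).eval E ^ 2 + (Chebyshev.S ℝ L).eval E ^ 2 -
      E * (Chebyshev.S ℝ (L - 1)).eval E * (Chebyshev.S ℝ L).eval E = 1 := by
  have := congrArg (Polynomial.eval E) (Polynomial.Chebyshev.S_sq_add_S_sq ℝ ((L : ℤ) - 1))
  simpa using this

theorem greenCubic_ofReal (K L : ℕ) (E : ℝ) (g : ℂ) :
    greenCubic K L E g =
      ((K * (Chebyshev.S ℝ (L - 1)).eval E : ℝ) : ℂ) * g ^ 3 +
      ((((K : ℝ) + 1) * (Chebyshev.S ℝ L).eval E : ℝ) : ℂ) * g ^ 2 +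
      ((E * (Chebyshev.S ℝ L).eval E : ℝ) : ℂ) * g + (((Chebyshev.S ℝ L).eval E : ℝ) : ℂ) := by
  simp only [greenCubic, eval_S_ofReal]
  push_cast
  ring

theorem exists_greenCubic_root_iff {E : ℝ} (hD : (Chebyshev.S ℝ L).eval E ≠ 0) :
    (∃ g : ℂ, 0 < g.im ∧ greenCubic K L E g = 0) ↔ (energyDiscr K L).eval E < 0 := by
  -- The discriminant of the cubic carries the square factor `S_L(E)²`.
  have hdisc : (18 * (K * (Chebyshev.S ℝ (L - 1)).eval E) *
      (((K : ℝ) + 1) * (Chebyshev.S ℝ L).eval E) * (E * (Chebyshev.S ℝ L).eval E) *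
      (Chebyshev.S ℝ L).eval E -
      4 * (((K : ℝ) + 1) * (Chebyshev.S ℝ L).eval E) ^ 3 * (Chebyshev.S ℝ L).eval E +
      (((K : ℝ) + 1) * (Chebyshev.S ℝ L).eval E) ^ 2 * (E * (Chebyshev.S ℝ L).eval E) ^ 2 -
      4 * (K * (Chebyshev.S ℝ (L - 1)).eval E) * (E * (Chebyshev.S ℝ L).eval E) ^ 3 -
      27 * (K * (Chebyshev.S ℝ (L - 1)).eval E) ^ 2 * (Chebyshev.S ℝ L).eval E ^ 2) =
      (Chebyshev.S ℝ L).eval E ^ 2 * (energyDiscr K L).eval E := by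
    rw [energyDiscr_eval]; ring
  have hD2 : 0 < (Chebyshev.S ℝ L).eval E ^ 2 := by positivity
  constructor
  · rintro ⟨g, hg, h⟩
    rw [greenCubic_ofReal] at h
    have := discr_neg_of_root (mul_ne_zero (by positivity) hD) hg h
    rw [hdisc] at this
    exact (pos_iff_neg_of_mul_neg this).1 hD2
  · intro h
    obtain ⟨g, hg, h'⟩ := exists_root_of_discr_neg
      (hdisc.trans_lt (mul_neg_of_pos_of_neg hD2 h))
    exact ⟨g, hg, by rw [greenCubic_ofReal]; exact h'⟩

theorem tendsto_greenCubic {l : Filter ℂ} {z₀ g : ℂ} {f : ℂ → ℂ} (hl : Tendsto id l (𝓝 z₀))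
    (h : Tendsto f l (𝓝 g)) :
    Tendsto (fun z => greenCubic K L z (f z)) l (𝓝 (greenCubic K L z₀ g)) := by
  have h2 : ContinuousAt (fun w : ℂ × ℂ => greenCubic K L w.1 w.2) (z₀, g) :=
    (continuous_greenCubic K L).continuousAt
  have h3 := h2.tendsto.comp (hl.prodMk_nhds h)
  exact h3

theorem greenCubic_eq_zero_of_tendsto (hL : 1 ≤ L) {l : Filter ℂ} [l.NeBot] {E : ℝ} {g : ℂ}
    (hl : l ≤ nhdsAbove E) (h : Tendsto (green K L 0) l (𝓝 g)) : greenCubic K L E g = 0 := by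
  refine tendsto_nhds_unique (tendsto_greenCubic (tendsto_id'.2 (hl.trans (nhdsAbove_le E))) h)
    ((tendsto_congr' ?_).2 tendsto_const_nhds)
  filter_upwards [hl (eventually_nhdsAbove_im_pos E)] with z hz using greenCubic_green hL hz

/-- At a zero of `S_L` only the cubic term survives, and `S_{L-1}` is nonzero there by
`eval_S_sq_add`; hence `0` would be the only root. -/
theorem eval_S_ne_zero_of_greenCubic (hK : 1 ≤ K) {E : ℝ} {g : ℂ} (hg : g ≠ 0)
    (h : greenCubic K L E g = 0) : (Chebyshev.S ℝ L).eval E ≠ 0 := by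
  intro hD
  have h1 := eval_S_sq_add L E
  rw [greenCubic_ofReal] at h
  rw [hD] at h h1
  have hK' : (K : ℝ) ≠ 0 := by positivity
  have : (Chebyshev.S ℝ (L - 1)).eval E ≠ 0 := fun h0 => by simp [h0] at h1
  have h' : ((K * (Chebyshev.S ℝ (L - 1)).eval E : ℝ) : ℂ) * g ^ 3 = 0 := by simpa using h
  refine mul_ne_zero ?_ (pow_ne_zero 3 hg) h'
  exact_mod_cast mul_ne_zero hK' this

/-- The complex-analytic continuation of the Green's function through the energy set. -/
theorem exists_analyticAt_green (hL : 1 ≤ L) {E : ℝ} {g : ℂ}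
    (hD : (Chebyshev.S ℝ L).eval E ≠ 0) (hg : 0 < g.im) (h : greenCubic K L E g = 0) :
    ∃ f : ℂ → ℂ, AnalyticAt ℂ f E ∧ ∀ᶠ x : ℝ in 𝓝 E,
      0 < (f x).im ∧ Tendsto (green K L 0) (nhdsAbove x) (𝓝 (f x)) := by
  set F : ℂ × ℂ → ℂ := fun w => greenCubic K L w.1 w.2 with hF
  have hS : ∀ n : ℤ, ContDiff ℂ ⊤ fun w : ℂ × ℂ => (Chebyshev.S ℂ n).eval w.1 := fun n => by
    have := ((Chebyshev.S ℂ n).contDiff_aeval (𝕜 := ℂ) ⊤).comp (contDiff_fst (E := ℂ) (F := ℂ))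
    simpa [Function.comp_def] using this
  have hcd : ContDiff ℂ ⊤ F := by
    have h1 := hS L
    have h2 := hS (L - 1)
    simp only [hF, greenCubic]
    fun_prop
  have hcdf : ContDiffAt ℂ ⊤ F ((E : ℂ), g) := hcd.contDiffAt
  have hfd : HasFDerivAt F (fderiv ℂ F ((E : ℂ), g)) ((E : ℂ), g) :=
    (hcdf.differentiableAt (by simp)).hasFDerivAt
  set a := K * (Chebyshev.S ℝ (L - 1)).eval E
  set b := ((K : ℝ) + 1) * (Chebyshev.S ℝ L).eval E
  set c := E * (Chebyshev.S ℝ L).eval E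
  have hder : fderiv ℂ F ((E : ℂ), g) (0, 1) = 3 * (a : ℂ) * g ^ 2 + 2 * b * g + c := by
    have h1 : HasDerivAt (fun y : ℂ => ((E : ℂ), y)) (0, 1) g :=
      (hasDerivAt_const g (E : ℂ)).prodMk (hasDerivAt_id g)
    have h2 := hfd.comp_hasDerivAt g h1
    have h3 : HasDerivAt (fun y : ℂ => (a : ℂ) * y ^ 3 + (b : ℂ) * y ^ 2 + (c : ℂ) * y +
        (((Chebyshev.S ℝ L).eval E : ℝ) : ℂ))
        ((a : ℂ) * (3 * g ^ 2) + (b : ℂ) * (2 * g) + c) g := by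
      have e1 := (hasDerivAt_pow 3 g).const_mul (a : ℂ)
      have e2 := (hasDerivAt_pow 2 g).const_mul (b : ℂ)
      have e3 := (hasDerivAt_id g).const_mul (c : ℂ)
      have := ((e1.add e2).add e3).add_const (((Chebyshev.S ℝ L).eval E : ℝ) : ℂ)
      simpa using this
    have h4 : F ∘ (fun y : ℂ => ((E : ℂ), y)) = fun y : ℂ => (a : ℂ) * y ^ 3 + (b : ℂ) * y ^ 2 +
        (c : ℂ) * y + (((Chebyshev.S ℝ L).eval E : ℝ) : ℂ) :=
      funext fun y => greenCubic_ofReal K L E y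
    rw [h4] at h2
    rw [h2.unique h3]
    ring
  -- The nonreal root is simple, so the cubic can be solved for `g` near `E`.
  have hne : fderiv ℂ F ((E : ℂ), g) (0, 1) ≠ 0 := by
    rw [hder]
    rw [greenCubic_ofReal] at h
    exact deriv_ne_zero_of_root (mul_ne_zero (by positivity) hD) hg h
  have hinv : (fderiv ℂ F ((E : ℂ), g) ∘L .inr ℂ ℂ ℂ).IsInvertible := by
    refine ⟨ContinuousLinearEquiv.unitsEquivAut ℂ (Units.mk0 _ hne), ?_⟩
    ext
    simp
  set f := hcdf.implicitFunction (by simp) hinv with hf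
  have hfE : f E = g := hcdf.implicitFunction_apply_self (by simp) hinv
  have han : AnalyticAt ℂ f E :=
    (hcdf.contDiffAt_implicitFunction (by simp) hinv).analyticAt
  have h0 : ∀ᶠ z in 𝓝 (E : ℂ), greenCubic K L z (f z) = 0 := by
    filter_upwards [hcdf.eventually_apply_implicitFunction (by simp) hinv] with z hz
    exact hz.trans h
  have h1 : ∀ᶠ z in 𝓝 (E : ℂ), 0 < (f z).im := by
    have : Tendsto (fun z => (f z).im) (𝓝 (E : ℂ)) (𝓝 (f E).im) :=
      (Complex.continuous_im.tendsto _).comp han.continuousAt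
    exact this.eventually_const_lt (by rw [hfE]; exact hg)
  have hall : ∀ᶠ z in 𝓝 (E : ℂ), 0 < (f z).im ∧ ContinuousAt f z ∧
      ∀ᶠ w in 𝓝 z, greenCubic K L w (f w) = 0 ∧ 0 < (f w).im := by
    filter_upwards [h1, han.eventually_analyticAt, (h0.and h1).eventually_nhds] with z a1 a2 a3
    exact ⟨a1, a2.continuousAt, a3⟩
  refine ⟨f, han, ?_⟩
  filter_upwards [(Complex.continuous_ofReal.tendsto E).eventually hall] with x hx
  obtain ⟨a1, a2, a3⟩ := hx
  refine ⟨a1, (a2.tendsto.mono_left (nhdsAbove_le x)).congr' ?_⟩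
  filter_upwards [nhdsAbove_le x a3, eventually_nhdsAbove_im_pos x] with z hz hz'
  -- Uniqueness of the root in the upper half-plane identifies the continued branch with the Green's
  -- function.
  exact (green_eq_of_greenCubic hL hz' hz.2 hz.1).symm

theorem mem_energySet_zero_iff (hK : 1 ≤ K) (hL : 1 ≤ L) {E : ℝ} :
    E ∈ energySet K L 0 ↔
      (Chebyshev.S ℝ L).eval E ≠ 0 ∧ (energyDiscr K L).eval E < 0 := by
  rw [mem_energySet]
  constructor
  · rintro ⟨g, hg, hi⟩
    have h := greenCubic_eq_zero_of_tendsto hL le_rfl hg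
    have hD := eval_S_ne_zero_of_greenCubic hK (ne_zero_of_im_pos hi) h
    exact ⟨hD, (exists_greenCubic_root_iff hD).1 ⟨g, hi, h⟩⟩
  · rintro ⟨hD, hQ⟩
    obtain ⟨g, hi, h⟩ := (exists_greenCubic_root_iff hD).2 hQ
    obtain ⟨f, -, hf⟩ := exists_analyticAt_green hL hD hi h
    obtain ⟨h1, h2⟩ := hf.self_of_nhds
    exact ⟨_, h2, h1⟩

theorem isOpen_energySet (hK : 1 ≤ K) (hL : 1 ≤ L) : IsOpen (energySet K L 0) := by
  have : energySet K L 0 = {E | (Chebyshev.S ℝ L).eval E ≠ 0} ∩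
      {E | (energyDiscr K L).eval E < 0} := ext fun E => mem_energySet_zero_iff hK hL
  rw [this]
  exact (isOpen_ne_fun (by fun_prop) continuous_const).inter
    (isOpen_lt (by fun_prop) continuous_const)

theorem analyticAt_greenBdry_labelBack (hK : 1 ≤ K) (hL : 1 ≤ L) {E : ℝ}
    (hE : E ∈ energySet K L 0) {j : ℕ} (hj : j ≤ L) :
    AnalyticAt ℝ (greenBdry K L (labelBack L j)) E := by
  induction j with
  | zero =>
    rw [labelBack_zero]
    obtain ⟨hD, hQ⟩ := (mem_energySet_zero_iff hK hL).1 hE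
    obtain ⟨g, hi, h⟩ := (exists_greenCubic_root_iff hD).2 hQ
    obtain ⟨f, han, hf⟩ := exists_analyticAt_green hL hD hi h
    have h1 : AnalyticAt ℝ (fun x : ℝ => f x) E :=
      (AnalyticAt.restrictScalars (𝕜 := ℝ) han).comp_of_eq (Complex.ofRealCLM.analyticAt E) rfl
    refine h1.congr ?_
    filter_upwards [hf] with x hx using (greenBdry_eq hx.2).symm
  | succ j ih =>
    have h1 := ih (by omega)
    have hlim : ∀ x ∈ energySet K L 0, (x : ℂ) + greenBdry K L (labelBack L j) x ≠ 0 ∧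
        -((x : ℂ) + greenBdry K L (labelBack L j) x)⁻¹ =
          greenBdry K L (labelBack L (j + 1)) x := by
      intro x hx
      rw [← energySet_labelBack (show j ≤ L by omega), mem_energySet] at hx
      obtain ⟨g, hg, hi⟩ := hx
      have h2 := ne_zero_of_im_pos (add_ofReal_im_pos x hi)
      rw [greenBdry_eq hg]
      exact ⟨h2, (greenBdry_eq (tendsto_green_succ (by omega) h2 hg)).symm⟩
    have h2 : AnalyticAt ℝ (fun x : ℝ => (x : ℂ) + greenBdry K L (labelBack L j) x) E :=
      (Complex.ofRealCLM.analyticAt E).add h1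
    refine (h2.inv (hlim E hE).1).neg.congr ?_
    filter_upwards [(isOpen_energySet hK hL).mem_nhds hE] with x hx using (hlim x hx).2

theorem analyticOnNhd_greenBdry (hK : 1 ≤ K) (hL : 1 ≤ L) (p : Fin (L + 1)) :
    AnalyticOnNhd ℝ (greenBdry K L p) (energySet K L 0) := by
  intro E hE
  obtain ⟨j, hj, rfl⟩ := exists_labelBack p
  exact analyticAt_greenBdry_labelBack hK hL hE hj

/-! ### Zeros of `S_L`; the energy set is non-empty, bounded and has finite frontier -/

theorem eval_S_two_mul_cos (n : ℤ) (θ : ℝ) :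
    (Chebyshev.S ℝ n).eval (2 * Real.cos θ) * Real.sin θ = Real.sin ((n + 1) * θ) := by
  rw [← Polynomial.Chebyshev.U_real_cos, ← Polynomial.Chebyshev.S_comp_two_mul_X,
    Polynomial.eval_comp]
  simp

/-- The largest zero of `S_L`. -/
theorem exists_eval_S_eq_zero (hL : 1 ≤ L) :
    ∃ E : ℝ, (Chebyshev.S ℝ L).eval E = 0 ∧ ∀ j : ℕ, j < L → (Chebyshev.S ℝ j).eval E ≠ 0 := by
  set θ : ℝ := Real.pi / (L + 1) with hθ
  have hL' : (0 : ℝ) < L + 1 := by positivity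
  have hpos : 0 < θ := by positivity
  have hlt : ∀ j : ℕ, j < L → ((j : ℝ) + 1) * θ < Real.pi := by
    intro j hj
    have : (j : ℝ) + 1 < L + 1 := by exact_mod_cast Nat.succ_lt_succ hj
    calc ((j : ℝ) + 1) * θ < (L + 1) * θ := by gcongr
      _ = Real.pi := by rw [hθ]; field_simp
  have hsin : 0 < Real.sin θ := by
    refine Real.sin_pos_of_pos_of_lt_pi hpos ?_
    simpa using hlt 0 hL
  refine ⟨2 * Real.cos θ, ?_, fun j hj h0 => ?_⟩
  · have h := eval_S_two_mul_cos L θ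
    have : ((L : ℤ) + 1 : ℝ) * θ = Real.pi := by rw [hθ]; push_cast; field_simp
    rw [this, Real.sin_pi] at h
    exact (mul_eq_zero.1 h).resolve_right hsin.ne'
  · have h := eval_S_two_mul_cos j θ
    rw [h0, zero_mul, Int.cast_natCast] at h
    exact absurd h (Real.sin_pos_of_pos_of_lt_pi (by positivity) (hlt j hj)).ne

/-- There `S_{L-1}² = 1`, so the value is `-27 K²`. Such a point is not in the energy set itself,
but all nearby points other than zeros of `S_L` are. -/
theorem energyDiscr_eval_neg_of_eval_S (hK : 1 ≤ K) {E : ℝ}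
    (hE : (Chebyshev.S ℝ L).eval E = 0) : (energyDiscr K L).eval E < 0 := by
  have h1 := eval_S_sq_add L E
  rw [energyDiscr_eval]
  rw [hE] at h1 ⊢
  have hK' : (1 : ℝ) ≤ K := by exact_mod_cast hK
  have h2 : (Chebyshev.S ℝ (L - 1)).eval E ^ 2 = 1 := by linarith
  rw [h2]
  nlinarith

theorem S_ne_zero (L : ℕ) : Chebyshev.S ℝ (L : ℤ) ≠ 0 := by
  intro h
  have := Polynomial.Chebyshev.S_eval_two ℝ (L : ℤ)
  rw [h, Polynomial.eval_zero, Int.cast_natCast] at this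
  have : (0 : ℝ) ≤ L := Nat.cast_nonneg L
  linarith

theorem finite_setOf_eval_eq_zero {P : Polynomial ℝ} (hP : P ≠ 0) :
    {E : ℝ | P.eval E = 0}.Finite :=
  (P.rootSet_finite ℝ).subset fun E hE => by
    rw [Polynomial.mem_rootSet]
    exact ⟨hP, by simpa using hE⟩

theorem energySet_nonempty (hK : 1 ≤ K) (hL : 1 ≤ L) : (energySet K L 0).Nonempty := by
  obtain ⟨E, hE, -⟩ := exists_eval_S_eq_zero hL
  have hopen : IsOpen {x | (energyDiscr K L).eval x < 0} :=
    isOpen_lt (by fun_prop) continuous_const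
  have hd : Dense {x : ℝ | (Chebyshev.S ℝ (L : ℤ)).eval x = 0}ᶜ :=
    (finite_setOf_eval_eq_zero (S_ne_zero L)).countable.dense_compl ℝ
  obtain ⟨x, hx1, hx2⟩ := hd.inter_open_nonempty _ hopen
    ⟨E, energyDiscr_eval_neg_of_eval_S hK hE⟩
  exact ⟨x, (mem_energySet_zero_iff hK hL).2 ⟨hx2, hx1⟩⟩

/-- Beyond the norm of the operator, `E` is in the resolvent set, so the root vector lies in the
range of `Δ - E` and the boundary value is real. -/
theorem energySet_bounded : Bornology.IsBounded (energySet K L 0) := by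
  refine (Metric.isBounded_closedBall (x := (0 : ℝ)) (r := ‖adj K L‖ *
    ‖(1 : EllTwo (Forest K L) →L[ℂ] EllTwo (Forest K L))‖)).subset fun E hE => ?_
  by_contra hn
  rw [Metric.mem_closedBall, dist_zero_right, not_le] at hn
  have hs : (E : ℂ) ∉ spectrum ℂ (adj K L) := fun h => by
    have := spectrum.norm_le_norm_mul_of_mem h
    rw [Complex.norm_real] at this
    linarith
  have h0 := tendsto_im_inner_opResolvent_of_range (adj_isSelfAdjoint K L)
    (sub_opResolvent_apply hs (site (forestRoot 0)))
  obtain ⟨g, hg, hi⟩ := mem_energySet.1 hE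
  have h1 := (Complex.continuous_im.tendsto g).comp (tendsto_nhdsAbove_iff.2 hg)
  simp_rw [← green_eq_inner] at h0
  exact hi.ne (tendsto_nhds_unique h0 h1)

theorem energyDiscr_ne_zero (hK : 1 ≤ K) (hL : 1 ≤ L) : energyDiscr K L ≠ 0 := by
  obtain ⟨E, hE, -⟩ := exists_eval_S_eq_zero hL
  intro h
  have := energyDiscr_eval_neg_of_eval_S hK hE
  simp [h] at this

theorem frontier_energySet_finite (hK : 1 ≤ K) (hL : 1 ≤ L) :
    (frontier (energySet K L 0)).Finite := by
  have hset : energySet K L 0 = {E | (Chebyshev.S ℝ (L : ℤ)).eval E = 0}ᶜ ∩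
      {E | (energyDiscr K L).eval E < 0} := ext fun E => mem_energySet_zero_iff hK hL
  have h1 := finite_setOf_eval_eq_zero (S_ne_zero L)
  have h2 := finite_setOf_eval_eq_zero (energyDiscr_ne_zero hK hL)
  refine (h1.union h2).subset ?_
  rw [hset]
  refine (frontier_inter_subset _ _).trans (union_subset_union ?_ ?_)
  · rw [frontier_compl]
    exact inter_subset_left.trans h1.isClosed.frontier_subset
  · exact inter_subset_right.trans
      (frontier_lt_subset_eq (Polynomial.continuous _) continuous_const)

theorem exceptionalSet_finite (L : ℕ) : (exceptionalSet L).Finite :=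
  (finite_Icc 1 L).biUnion fun _ _ => Module.End.finite_hasEigenvalue _

theorem closure_mainSet (hK : 1 ≤ K) (hL : 1 ≤ L) :
    closure (mainSet K L) = closure (energySet K L 0) :=
  closure_diff_finite (isOpen_energySet hK hL) (exceptionalSet_finite L)

theorem energySet_isUnion (hK : 1 ≤ K) (hL : 1 ≤ L) :
    IsNonemptyFiniteUnionOfIoo (energySet K L 0) :=
  isNonemptyFiniteUnionOfIoo_of_finite_frontier (isOpen_energySet hK hL)
    (energySet_nonempty hK hL) energySet_bounded (frontier_energySet_finite hK hL)

theorem mainSet_isUnion (hK : 1 ≤ K) (hL : 1 ≤ L) :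
    IsNonemptyFiniteUnionOfIoo (mainSet K L) := by
  have hf := exceptionalSet_finite L
  refine isNonemptyFiniteUnionOfIoo_of_finite_frontier
    ((isOpen_energySet hK hL).sdiff hf.isClosed) ?_
    (energySet_bounded.subset sdiff_subset) ?_
  · rw [← closure_nonempty_iff, closure_mainSet hK hL, closure_nonempty_iff]
    exact energySet_nonempty hK hL
  · refine ((frontier_energySet_finite hK hL).union hf).subset ?_
    rw [mainSet, sdiff_eq]
    refine (frontier_inter_subset _ _).trans (union_subset_union inter_subset_left ?_)
    rw [frontier_compl]
    exact inter_subset_right.trans hf.isClosed.frontier_subset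

/-! ### Intervals covered for large `K`, and the Fibonacci trees -/

theorem Icc_subset_closure_mainSet (hK : 1 ≤ K) (hL : 1 ≤ L) {E₀ : ℝ}
    (h : E₀ ^ 2 < 3 * ((K : ℝ) + 1)) : Icc (-E₀) E₀ ⊆ closure (mainSet K L) := by
  have hopen : IsOpen {x | (energyDiscr K L).eval x < 0} :=
    isOpen_lt (by fun_prop) continuous_const
  have hd : closure (energySet K L 0) = closure {x | (energyDiscr K L).eval x < 0} := by
    rw [← closure_diff_finite hopen (finite_setOf_eval_eq_zero (S_ne_zero L))]
    congr 1
    ext E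
    rw [mem_energySet_zero_iff hK hL]
    exact and_comm
  rw [closure_mainSet hK hL, hd]
  refine Subset.trans (fun E hE => ?_) subset_closure
  have hE2 : E ^ 2 < 3 * ((K : ℝ) + 1) := lt_of_le_of_lt (sq_le_sq' hE.1 hE.2) h
  have h1 := eval_S_sq_add L E
  rw [mem_ofPred_eq, energyDiscr_eval]
  set D := (Chebyshev.S ℝ L).eval E
  set a := (Chebyshev.S ℝ (L - 1)).eval E
  have hK' : (0 : ℝ) < K := by exact_mod_cast hK
  have hne : D ≠ 0 ∨ a ≠ 0 := by
    by_contra! h0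
    rw [h0.1, h0.2] at h1
    norm_num at h1
  -- Completing the square in `a`; the remainder collapses to a perfect cube, which decides the sign
  -- when `E² < 3(K+1)`.
  have key : 4 * 27 * (((K : ℝ) + 1) ^ 2 * D ^ 2 * (E ^ 2 - 4 * ((K : ℝ) + 1)) +
      K * D * a * (18 * ((K : ℝ) + 1) * E - 4 * E ^ 3) - 27 * (K : ℝ) ^ 2 * a ^ 2) =
      -(54 * K * a - D * (18 * ((K : ℝ) + 1) * E - 4 * E ^ 3)) ^ 2 -
        16 * D ^ 2 * (3 * ((K : ℝ) + 1) - E ^ 2) ^ 3 := by ring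
  have hpos : 0 < (3 * ((K : ℝ) + 1) - E ^ 2) ^ 3 := pow_pos (by linarith) 3
  by_cases hD : D = 0
  · have ha : a ≠ 0 := hne.resolve_left (not_not.2 hD)
    rw [hD] at key ⊢
    have : 0 < (K : ℝ) ^ 2 * a ^ 2 := by positivity
    linarith
  · have : 0 < D ^ 2 * (3 * ((K : ℝ) + 1) - E ^ 2) ^ 3 := mul_pos (by positivity) hpos
    nlinarith [sq_nonneg (54 * K * a - D * (18 * ((K : ℝ) + 1) * E - 4 * E ^ 3))]

theorem exceptionalSet_one : exceptionalSet 1 = {0} := by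
  have h0 : Matrix.toLin' (lineMatrix 1) = 0 := by
    have : lineMatrix 1 = 0 := by
      ext i j
      simp only [lineMatrix, Matrix.of_apply, Matrix.zero_apply]
      rw [if_neg]
      omega
    rw [this, map_zero]
  rw [exceptionalSet, Icc_self, biUnion_singleton, h0]
  ext E
  rw [mem_ofPred_eq, mem_singleton_iff]
  constructor
  · intro h
    obtain ⟨v, hv⟩ := h.exists_hasEigenvector
    have := hv.apply_eq_smul
    rw [LinearMap.zero_apply] at this
    exact (smul_eq_zero.1 this.symm).resolve_right hv.2
  · rintro rfl
    refine Module.End.hasEigenvalue_of_hasEigenvector (x := fun _ : Fin 1 => (1 : ℝ))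
      ⟨Module.End.mem_eigenspace_iff.2 (by simp), fun h => ?_⟩
    simpa using congrFun h (0 : Fin 1)

theorem mainSet_one_one :
    mainSet 1 1 = Ioo (-(3 / 2 * √3)) 0 ∪ Ioo 0 (3 / 2 * √3) := by
  have hs : √3 ^ 2 = (3 : ℝ) := Real.sq_sqrt (by norm_num)
  ext E
  rw [mainSet, exceptionalSet_one, Set.mem_sdiff, mem_energySet_zero_iff le_rfl le_rfl,
    energyDiscr_eval, mem_singleton_iff]
  simp only [Nat.cast_one, sub_self, Polynomial.Chebyshev.S_one, Polynomial.Chebyshev.S_zero,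
    Polynomial.eval_X, Polynomial.eval_one]
  -- For `K = L = 1` the quartic terms cancel.
  have e : ((1 : ℝ) + 1) ^ 2 * E ^ 2 * (E ^ 2 - 4 * (1 + 1)) +
      1 * E * 1 * (18 * (1 + 1) * E - 4 * E ^ 3) - 27 * 1 ^ 2 * 1 ^ 2 = 4 * E ^ 2 - 27 := by ring
  have hQ : 4 * E ^ 2 - 27 < 0 ↔ -(3 / 2 * √3) < E ∧ E < 3 / 2 * √3 := by
    rw [← abs_lt, ← abs_of_pos (show 0 < 3 / 2 * √3 by positivity), ← sq_lt_sq, mul_pow, hs]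
    constructor <;> intro h <;> linarith
  rw [e, hQ]
  constructor
  · rintro ⟨⟨h1, h2, h3⟩, -⟩
    rcases lt_or_gt_of_ne h1 with h | h
    · exact Or.inl ⟨h2, h⟩
    · exact Or.inr ⟨h, h3⟩
  · have hp : 0 < 3 / 2 * √3 := by positivity
    rintro (⟨h1, h2⟩ | ⟨h1, h2⟩)
    · exact ⟨⟨h2.ne, h1, by linarith⟩, h2.ne⟩
    · exact ⟨⟨h1.ne', by linarith, h2⟩, h1.ne'⟩

/-! ### Boundary values off the energy set -/

/-- The polynomial in `E` obtained by eliminating `g` from `greenCubic K L E g = 0` and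
`iterDen j E g = 0`. -/
noncomputable def branchPoly (K L j : ℕ) : Polynomial ℝ :=
  -(Polynomial.C (K : ℝ) * Chebyshev.S ℝ (L - 1) * Chebyshev.S ℝ j ^ 3) +
    Chebyshev.S ℝ L * Chebyshev.S ℝ (j - 1) *
      (Polynomial.C ((K : ℝ) + 1) * Chebyshev.S ℝ j ^ 2 -
        Polynomial.X * Chebyshev.S ℝ j * Chebyshev.S ℝ (j - 1) + Chebyshev.S ℝ (j - 1) ^ 2)

theorem branchPoly_eval (K L j : ℕ) (E : ℝ) : (branchPoly K L j).eval E =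
    -(K * (Chebyshev.S ℝ (L - 1)).eval E * (Chebyshev.S ℝ j).eval E ^ 3) +
      (Chebyshev.S ℝ L).eval E * (Chebyshev.S ℝ (j - 1)).eval E *
      (((K : ℝ) + 1) * (Chebyshev.S ℝ j).eval E ^ 2 -
        E * (Chebyshev.S ℝ j).eval E * (Chebyshev.S ℝ (j - 1)).eval E +
          (Chebyshev.S ℝ (j - 1)).eval E ^ 2) := by
  simp [branchPoly]

/-- For `j < L`, evaluate at the largest zero of `S_L`, where `S_{L-1}` and `S_j` are nonzero. For
`j = L`, evaluate at `2`, where `S_n(2) = n + 1` and the value is `L (L + 1)`. -/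
theorem branchPoly_ne_zero (hK : 1 ≤ K) (hL : 1 ≤ L) {j : ℕ} (hj : j ≤ L) :
    branchPoly K L j ≠ 0 := by
  have hK' : (0 : ℝ) < K := by exact_mod_cast hK
  have hL' : (0 : ℝ) < L := by exact_mod_cast hL
  intro h
  rcases hj.lt_or_eq with hj | rfl
  · obtain ⟨E, hE, hne⟩ := exists_eval_S_eq_zero hL
    have h1 := branchPoly_eval K L j E
    have h2 := eval_S_sq_add L E
    rw [hE] at h2
    have ha : (Chebyshev.S ℝ (L - 1)).eval E ≠ 0 := fun h0 => by simp [h0] at h2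
    rw [h, Polynomial.eval_zero, hE, zero_mul, zero_mul, add_zero] at h1
    exact neg_ne_zero.2 (mul_ne_zero (mul_ne_zero hK'.ne' ha) (pow_ne_zero 3 (hne j hj))) h1.symm
  · have h1 := branchPoly_eval K j j 2
    rw [h, Polynomial.eval_zero, Polynomial.Chebyshev.S_eval_two,
      Polynomial.Chebyshev.S_eval_two] at h1
    push_cast at h1
    have : (j : ℝ) * (j + 1) = 0 := by linear_combination -h1
    have : 0 < (j : ℝ) * (j + 1) := by positivity
    linarith

/-- The energies where some Green's function may be unbounded off the energy set. -/
def branchSet (K L : ℕ) : Set ℝ := ⋃ j ∈ Iic L, {E | (branchPoly K L j).eval E = 0}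

theorem branchSet_finite (hK : 1 ≤ K) (hL : 1 ≤ L) : (branchSet K L).Finite :=
  (finite_Iic L).biUnion fun _ hj => finite_setOf_eval_eq_zero (branchPoly_ne_zero hK hL hj)

theorem iterDen_ne_zero_of_notMem_branchSet {E : ℝ} (hE : E ∉ branchSet K L) {g : ℂ}
    (hg : greenCubic K L E g = 0) {j : ℕ} (hj : j ≤ L) : iterDen j E g ≠ 0 := by
  intro h
  refine hE (mem_biUnion (mem_Iic.2 hj) ?_)
  rw [mem_ofPred_eq, branchPoly_eval]
  rw [greenCubic_ofReal] at hg
  rw [iterDen, eval_S_ofReal, eval_S_ofReal] at h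
  set A := (Chebyshev.S ℝ j).eval E
  set B := (Chebyshev.S ℝ (j - 1)).eval E
  set D := (Chebyshev.S ℝ L).eval E
  set a := (Chebyshev.S ℝ (L - 1)).eval E
  have hC : (((-(K * a * A ^ 3) + D * B * ((K + 1) * A ^ 2 - E * A * B + B ^ 2) : ℝ)) : ℂ) = 0 := by
    have hA : (A : ℂ) = -(B * g) := by linear_combination h
    push_cast at hg ⊢
    rw [hA]
    -- Substituting `A = -B g` turns the branch polynomial into `B³` times the cubic, so no division
    -- by `B` is needed.
    linear_combination (B : ℂ) ^ 3 * hg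
  exact_mod_cast hC

/-- A family of roots of cubics with converging coefficients has a limit along an ultrafilter,
unless the leading coefficient tends to zero. -/
theorem exists_tendsto_of_cubic {l : Ultrafilter ℂ} {a b c d f : ℂ → ℂ} {a₀ b₀ c₀ d₀ : ℂ}
    (ha : Tendsto a l (𝓝 a₀)) (hb : Tendsto b l (𝓝 b₀)) (hc : Tendsto c l (𝓝 c₀))
    (hd : Tendsto d l (𝓝 d₀)) (ha₀ : a₀ ≠ 0) (hf0 : ∀ᶠ z in l, f z ≠ 0)
    (h : ∀ᶠ z in l, a z * f z ^ 3 + b z * f z ^ 2 + c z * f z + d z = 0) :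
    ∃ g, Tendsto f l (𝓝 g) := by
  by_cases hbdd : ∃ s, Bornology.IsBounded s ∧ ∀ᶠ z in l, f z ∈ s
  · obtain ⟨s, hs, hfs⟩ := hbdd
    obtain ⟨g, -, hg⟩ := hs.isCompact_closure.ultrafilter_le_nhds (l.map f)
      (le_principal_iff.2 (hfs.mono fun z hz => subset_closure hz))
    exact ⟨g, hg⟩
  · push Not at hbdd
    -- An ultrafilter that is not eventually in a bounded set is eventually outside it. Dividing the
    -- cubic equation by `f³` then forces `a₀ = 0`.
    have hcob : Tendsto f l (Bornology.cobounded ℂ) := by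
      intro s hs
      have h1 := hbdd sᶜ (Bornology.isBounded_compl_iff.2 hs)
      exact h1.mono fun z hz => not_not.1 hz
    have hinv := tendsto_inv₀_cobounded.comp hcob
    have hlim := ((ha.add (hb.mul hinv)).add (hc.mul (hinv.pow 2))).add (hd.mul (hinv.pow 3))
    have hzero : Tendsto (fun z => a z + b z * (Inv.inv ∘ f) z + c z * (Inv.inv ∘ f) z ^ 2 +
        d z * (Inv.inv ∘ f) z ^ 3) l (𝓝 0) := by
      refine (tendsto_congr' ?_).2 tendsto_const_nhds
      filter_upwards [h, hf0] with z hz hz0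
      simp only [Function.comp_apply]
      field_simp
      linear_combination hz
    have := tendsto_nhds_unique hlim hzero
    simp at this
    exact absurd this ha₀

theorem continuous_eval_S (n : ℤ) : Continuous fun z : ℂ => (Chebyshev.S ℂ n).eval z := by
  fun_prop

/-- Ultrafilters avoid having to show that the Green's function selects a single root. Any limit of
`Γ_0` solves the cubic at `E` with nonnegative imaginary part, and a positive one would put `E` in
the energy set. -/
theorem exists_real_limit_green (hK : 1 ≤ K) (hL : 1 ≤ L) {E : ℝ} (hE : E ∉ energySet K L 0)
    (hE' : E ∉ branchSet K L) {l : Ultrafilter ℂ} (hl : (l : Filter ℂ) ≤ nhdsAbove E)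
    (p : Fin (L + 1)) : ∃ r : ℝ, Tendsto (green K L p) l (𝓝 (r : ℂ)) := by
  have hl' : Tendsto id (l : Filter ℂ) (𝓝 (E : ℂ)) := tendsto_id'.2 (hl.trans (nhdsAbove_le E))
  have him : ∀ᶠ z in (l : Filter ℂ), 0 < z.im := hl (eventually_nhdsAbove_im_pos E)
  have hS : ∀ n : ℤ, Tendsto (fun z : ℂ => (Chebyshev.S ℂ n).eval z) l
      (𝓝 ((Chebyshev.S ℂ n).eval (E : ℂ))) := fun n =>
    ((continuous_eval_S n).tendsto (E : ℂ)).comp hl'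
  have ha₀ : (K : ℂ) * (Chebyshev.S ℂ (L - 1)).eval (E : ℂ) ≠ 0 := by
    rw [eval_S_ofReal]
    intro h0
    have h0' : (K : ℝ) * (Chebyshev.S ℝ (L - 1)).eval E = 0 := by exact_mod_cast h0
    -- The index `j = 0`, with `S_0 = 1` and `S_{-1} = 0`, puts the zeros of the leading coefficient
    -- into the branch set.
    refine hE' (mem_biUnion (mem_Iic.2 (Nat.zero_le L)) ?_)
    rw [mem_ofPred_eq, branchPoly_eval, h0']
    simp
  obtain ⟨g, hg⟩ : ∃ g, Tendsto (green K L 0) l (𝓝 g) := by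
    refine exists_tendsto_of_cubic ((hS (L - 1)).const_mul (K : ℂ))
      ((hS L).const_mul ((K : ℂ) + 1)) (hl'.mul (hS L)) (hS L) ha₀ ?_ ?_
    · filter_upwards [him] with z hz using ne_zero_of_im_pos (green_im_pos hz 0)
    · filter_upwards [him] with z hz using greenCubic_green hL hz
  have hcub := greenCubic_eq_zero_of_tendsto hL hl hg
  have hgim : 0 ≤ g.im := by
    refine ge_of_tendsto ((Complex.continuous_im.tendsto g).comp hg) ?_
    filter_upwards [him] with z hz using (green_im_pos hz 0).le
  have hg0 : g.im = 0 := by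
    by_contra hne
    have hpos : 0 < g.im := lt_of_le_of_ne hgim (Ne.symm hne)
    have hD := eval_S_ne_zero_of_greenCubic hK (ne_zero_of_im_pos hpos) hcub
    exact hE ((mem_energySet_zero_iff hK hL).2
      ⟨hD, (exists_greenCubic_root_iff hD).1 ⟨g, hpos, hcub⟩⟩)
  obtain ⟨r, rfl⟩ : ∃ r : ℝ, g = r := ⟨g.re, Complex.ext rfl (by simp [hg0])⟩
  obtain ⟨j, hj, rfl⟩ := exists_labelBack p
  have hne := iterDen_ne_zero_of_notMem_branchSet hE' hcub hj
  have hden : ∀ n : ℤ, Tendsto (fun z => iterDen n z (green K L 0 z)) l (𝓝 (iterDen n E r)) :=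
    fun n => (hS n).add ((hS (n - 1)).mul hg)
  have hreal : ∀ n : ℤ, iterDen n E r =
      (((Chebyshev.S ℝ n).eval E + (Chebyshev.S ℝ (n - 1)).eval E * r : ℝ) : ℂ) := fun n => by
    rw [iterDen, eval_S_ofReal, eval_S_ofReal]; push_cast; rfl
  have hlim : Tendsto (green K L (labelBack L j)) l (𝓝 (-iterDen (j - 1) E r / iterDen j E r)) := by
    refine ((hden (j - 1)).neg.div (hden j) hne).congr' ?_
    filter_upwards [him] with z hz
    obtain ⟨h1, h2⟩ := mul_iterDen (g := fun p => green K L p z) (green_system hz) j hj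
    exact (eq_div_of_mul_eq h1 h2).symm
  rw [hreal, hreal, ← Complex.ofReal_neg, ← Complex.ofReal_div] at hlim
  exact ⟨_, hlim⟩

theorem tendsto_im_inner_site (hK : 1 ≤ K) (hL : 1 ≤ L) {E : ℝ} (hE : E ∉ energySet K L 0)
    (hE' : E ∉ branchSet K L) (x : Forest K L) :
    Tendsto (fun η : ℝ => (inner ℂ (site x)
      (opResolvent (adj K L) ((E : ℂ) + η * Complex.I) (site x))).im) (𝓝[>] 0) (𝓝 0) := by
  have h : Tendsto (fun z => (inner ℂ (site x) (opResolvent (adj K L) z (site x))).im)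
      (nhdsAbove E) (𝓝 0) := by
    rw [tendsto_iff_ultrafilter]
    intro l hl
    have him : ∀ᶠ z in (l : Filter ℂ), 0 < z.im := hl (eventually_nhdsAbove_im_pos E)
    obtain ⟨-, -, r, hr⟩ := exists_real_limit_opResolvent (S := substMatrix K L) (l := l)
      (him.mono fun z hz => notMem_spectrum_adj hz)
      (fun p => by
        simp_rw [← inner_site]
        exact (exists_real_limit_green hK hL hE hE' hl p).imp fun r hr =>
          hr.congr fun z => green_eq_inner p z) x.2
    simp_rw [inner_site]
    have := (Complex.continuous_im.tendsto (r : ℂ)).comp hr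
    rwa [Complex.ofReal_im] at this
  rw [nhdsAbove, tendsto_map'_iff] at h
  exact h

/-! ### The absolutely continuous spectrum of the forest -/

theorem mem_of_forall_site_mem {V : Submodule ℂ (EllTwo (Forest K L))}
    (hV : IsClosed (V : Set (EllTwo (Forest K L)))) (h : ∀ x, site x ∈ V)
    (ψ : EllTwo (Forest K L)) : ψ ∈ V := by
  classical
  refine hV.mem_of_tendsto (lp.hasSum_single (by simp) ψ) (Eventually.of_forall fun s => ?_)
  refine V.sum_mem fun x _ => ?_
  have : lp.single 2 x (ψ x) = ψ x • site x := by
    ext y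
    rw [lp.coeFn_smul, Pi.smul_apply, site_apply, lp.coeFn_single, Pi.single_apply]
    split_ifs with h
    · simp
    · simp
  rw [this]
  exact V.smul_mem _ (h x)

/-- Off the energy set and the branch set, vertex vectors, hence by density all vectors, carry no
mass. Absolute continuity of `ψ` is needed only for the finite branch set, where point masses are
possible. -/
theorem spectralMeasure_compl_closure_energySet (hK : 1 ≤ K) (hL : 1 ≤ L)
    {ψ : EllTwo (Forest K L)} (hψ : ψ ∈ acSubmodule (adj_isSelfAdjoint K L)) :
    spectralMeasure (adj K L) (adj_isSelfAdjoint K L) ψ (closure (energySet K L 0))ᶜ = 0 := by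
  have h0 (x : Forest K L) : site x ∈ spectralNullSubspace (adj_isSelfAdjoint K L)
      (energySet K L 0 ∪ branchSet K L)ᶜ :=
    spectralMeasure_eq_zero_of_tendsto_zero (adj_isSelfAdjoint K L) (site x) fun E hE =>
      tendsto_im_inner_site hK hL (fun h => hE (Or.inl h)) (fun h => hE (Or.inr h)) x
  have h1 : spectralMeasure (adj K L) (adj_isSelfAdjoint K L) ψ
      (energySet K L 0 ∪ branchSet K L)ᶜ = 0 :=
    mem_of_forall_site_mem (isClosed_spectralNullSubspace _ _) h0 ψ
  have h2 : spectralMeasure (adj K L) (adj_isSelfAdjoint K L) ψ (branchSet K L) = 0 := by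
    simp only [acSubmodule, Submodule.mem_iInf, mem_spectralNullSubspace] at hψ
    exact hψ _ ((branchSet_finite hK hL).measure_zero volume)
  refine measure_mono_null (fun E hE => ?_) (measure_union_null h1 h2)
  by_cases hb : E ∈ branchSet K L
  · exact Or.inr hb
  · exact Or.inl fun h => h.elim (fun h => hE (subset_closure h)) hb

theorem acSpectrum_adj (hK : 1 ≤ K) (hL : 1 ≤ L) :
    acSpectrum (adj K L) (adj_isSelfAdjoint K L) = closure (energySet K L 0) := by
  refine Subset.antisymm (fun E hE => ?_) fun E hE => ?_
  · by_contra hn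
    exact notMem_acSpectrum (adj_isSelfAdjoint K L) isClosed_closure.isOpen_compl
      (fun ψ hψ => spectralMeasure_compl_closure_energySet hK hL hψ) hn hE
  · refine mem_acSpectrum_of_mem_closure (adj_isSelfAdjoint K L) (isOpen_energySet hK hL)
      (φ := site (forestRoot 0)) (fun x hx => ?_) hE
    obtain ⟨g, hg, hi⟩ := mem_energySet.1 hx
    refine ⟨g.im, hi, ?_⟩
    simp_rw [← green_eq_inner]
    exact (Complex.continuous_im.tendsto g).comp (tendsto_nhdsAbove_iff.2 hg)

end FibTree

theorem proposition1p1 :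
    (∀ K L : ℕ, 1 ≤ K → 1 ≤ L →
      -- (i)
      ((∀ p, FibTree.energySet K L p = FibTree.energySet K L 0) ∧
        IsNonemptyFiniteUnionOfIoo (FibTree.energySet K L 0) ∧
        IsNonemptyFiniteUnionOfIoo (FibTree.mainSet K L) ∧
        ∀ p, AnalyticOnNhd ℝ (FibTree.greenBdry K L p) (FibTree.energySet K L 0)) ∧
      -- (ii)
      (acSpectrum (FibTree.adj K L) (FibTree.adj_isSelfAdjoint K L) =
          closure (FibTree.mainSet K L) ∧
        closure (FibTree.mainSet K L) = closure (FibTree.energySet K L 0))) ∧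
    -- (iii)
    (∀ L : ℕ, 1 ≤ L → ∀ E₀ : ℝ, ∃ K₀ : ℕ, ∀ K : ℕ, K₀ < K →
      Set.Icc (-E₀) E₀ ⊆ closure (FibTree.mainSet K L)) ∧
    -- (iv)
    FibTree.mainSet 1 1 =
      Set.Ioo (-(3 / 2 * √3)) 0 ∪ Set.Ioo 0 (3 / 2 * √3) := by
  refine ⟨fun K L hK hL => ⟨⟨FibTree.energySet_eq, FibTree.energySet_isUnion hK hL,
    FibTree.mainSet_isUnion hK hL, FibTree.analyticOnNhd_greenBdry hK hL⟩,
    (FibTree.acSpectrum_adj hK hL).trans (FibTree.closure_mainSet hK hL).symm,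
    FibTree.closure_mainSet hK hL⟩, fun L hL E₀ => ?_, FibTree.mainSet_one_one⟩
  -- Then `E₀² < K₀ < K`, more than enough for `E₀² < 3(K+1)`.
  obtain ⟨K₀, hK₀⟩ := exists_nat_gt (E₀ ^ 2)
  refine ⟨K₀, fun K hK => FibTree.Icc_subset_closure_mainSet (by omega) hL ?_⟩
  have : (K₀ : ℝ) < K := by exact_mod_cast hK
  have h0 : (0 : ℝ) ≤ K := Nat.cast_nonneg K
  linarith
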